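/- Let $n \in \{6,7,8\}$, let $\Bbbk$ be an algebraically closed field of characteristic $2$, and let $G$ be a (simply connected) simple algebraic group of type $E_n$ over $\Bbbk$ with Lie algebra $\mathfrak{g} = \mathrm{Lie}(G) = \mathfrak{g}_{\mathbb{Z}} \otimes_{\mathbb{Z}} \Bbbk$, where $\mathfrak{g}_{\mathbb{Z}}$ is the $\mathbb{Z}$-span of a Chevalley basis $\{e_\alpha : \alpha \in \Phi\} \cup \{h_1, \dots, h_n\}$ of the complex simple Lie algebra of type $E_n$; here $\Phi$ is the root system of type $E_n$ and its simple roots $\alpha_1, \dots, \alpha_n$ are numbered as in Bourbaki. Let $\mathcal{O}(A_1^3)$ be the orbit of $e_{\alpha_1} + e_{\alpha_4} + e_{\alpha_6}$ under the adjoint action of $G$ on $\mathfrak{g}$ (for $n = 7$ this is the orbit usually labelled $(A_1^3)'$). For $e \in \mathcal{O}(A_1^3)$, in particular for $e = e_{\alpha_1} + e_{\alpha_4} + e_{\alpha_6}$, let $\mathfrak{n}_e = \{x \in \mathfrak{g} : [x,e] \in \Bbbk e\}$, let $A$ be the solvable radical of $\mathfrak{n}_e$, and let $M_n = N_{\mathfrak{g}}(A)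 = \{x \in \mathfrak{g} : [x,A] \subseteq A\}$. Then $M_n$ has dimension $43$, $74$ or $141$ for $n = 6, 7, 8$ respectively, and $M_n$ is a maximal subalgebra of $\mathfrak{g}$, that is, a proper Lie subalgebra that is contained in no other proper Lie subalgebra of $\mathfrak{g}$. -/

import Mathlib

/-! ## Simply laced exceptional Lie algebras over a field of characteristic two -/

/-- `C` is the Cartan matrix of a (reduced, simply laced) root system of finite type:
it is symmetric and positive definite with all diagonal entries equal to `2`. -/
class IsADECartan {n : ℕ} (C : Matrix (Fin n) (Fin n) ℤ) : Prop where
  symm : ∀ i j, C i j = C j i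
  diag : ∀ i, C i i = 2
  pos : ∀ a : Fin n → ℤ, a ≠ 0 → 0 < dotProduct a (C.mulVec a)

theorem isADECartan_aux (x0 x1 x2 x3 x4 x5 x6 x7 : ℤ)
    (h : x0 ^ 2 + x1 ^ 2 + x2 ^ 2 + x3 ^ 2 + x4 ^ 2 + x5 ^ 2 + x6 ^ 2 + x7 ^ 2
      - x0 * x2 - x2 * x3 - x1 * x3 - x3 * x4 - x4 * x5 - x5 * x6 - x6 * x7 ≤ 0) :
    x0 = 0 ∧ x1 = 0 ∧ x2 = 0 ∧ x3 = 0 ∧ x4 = 0 ∧ x5 = 0 ∧ x6 = 0 ∧ x7 = 0 := by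
  have s0 := sq_nonneg (2 * x0 - x2)
  have s1 := sq_nonneg (2 * x1 - x3)
  have s2 := sq_nonneg (3 * x2 - 2 * x3)
  have s7 := sq_nonneg (2 * x7 - x6)
  have s6 := sq_nonneg (3 * x6 - 2 * x5)
  have s5 := sq_nonneg (4 * x5 - 3 * x4)
  have s4 := sq_nonneg (5 * x4 - 4 * x3)
  have h3 : x3 = 0 := by
    have : x3 ^ 2 ≤ 0 := by linarith
    nlinarith
  subst h3
  have h4 : x4 = 0 := by
    have : x4 ^ 2 ≤ 0 := by linarith
    nlinarith
  have h1 : x1 = 0 := by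
    have : x1 ^ 2 ≤ 0 := by linarith
    nlinarith
  have h2 : x2 = 0 := by
    have : x2 ^ 2 ≤ 0 := by linarith
    nlinarith
  subst h4 h2
  have h0 : x0 = 0 := by
    have : x0 ^ 2 ≤ 0 := by linarith
    nlinarith
  have h5 : x5 = 0 := by
    have : x5 ^ 2 ≤ 0 := by linarith
    nlinarith
  subst h5
  have h6 : x6 = 0 := by
    have : x6 ^ 2 ≤ 0 := by linarith
    nlinarith
  subst h6
  have h7 : x7 = 0 := by
    have : x7 ^ 2 ≤ 0 := by linarith
    nlinarith
  exact ⟨h0, h1, rfl, rfl, rfl, rfl, rfl, h7⟩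

instance isADECartan_E₆ : IsADECartan CartanMatrix.E₆ where
  symm i j := by fin_cases i <;> fin_cases j <;> rfl
  diag i := by fin_cases i <;> rfl
  pos a ha := by
    by_contra hcon
    apply ha
    simp only [CartanMatrix.E₆, Matrix.mulVec, dotProduct, Fin.sum_univ_six] at hcon
    simp at hcon
    obtain ⟨h0, h1, h2, h3, h4, h5, -, -⟩ :=
      isADECartan_aux (a 0) (a 1) (a 2) (a 3) (a 4) (a 5) 0 0 (by linarith)
    funext i
    fin_cases i <;> assumption

instance isADECartan_E₇ : IsADECartan CartanMatrix.E₇ where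
  symm i j := by fin_cases i <;> fin_cases j <;> rfl
  diag i := by fin_cases i <;> rfl
  pos a ha := by
    by_contra hcon
    apply ha
    simp only [CartanMatrix.E₇, Matrix.mulVec, dotProduct, Fin.sum_univ_seven] at hcon
    simp at hcon
    obtain ⟨h0, h1, h2, h3, h4, h5, h6, -⟩ :=
      isADECartan_aux (a 0) (a 1) (a 2) (a 3) (a 4) (a 5) (a 6) 0 (by linarith)
    funext i
    fin_cases i <;> assumption

instance isADECartan_E₈ : IsADECartan CartanMatrix.E₈ where
  symm i j := by fin_cases i <;> fin_cases j <;> rfl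
  diag i := by fin_cases i <;> rfl
  pos a ha := by
    by_contra hcon
    apply ha
    simp only [CartanMatrix.E₈, Matrix.mulVec, dotProduct, Fin.sum_univ_eight] at hcon
    simp at hcon
    obtain ⟨h0, h1, h2, h3, h4, h5, h6, h7⟩ :=
      isADECartan_aux (a 0) (a 1) (a 2) (a 3) (a 4) (a 5) (a 6) (a 7) (by linarith)
    funext i
    fin_cases i <;> assumption

/-- The roots: the elements `a = ∑ aᵢ αᵢ` of the root lattice (written in coordinates with
respect to the simple roots `αᵢ`) with `(a | a) = 2`, where `(αᵢ | αⱼ) = C i j`. -/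
def IsRoot {n : ℕ} (C : Matrix (Fin n) (Fin n) ℤ) (a : Fin n → ℤ) : Prop :=
  dotProduct a (C.mulVec a) = 2

/-- The root system with Cartan matrix `C`. -/
abbrev Root {n : ℕ} (C : Matrix (Fin n) (Fin n) ℤ) : Type := {a : Fin n → ℤ // IsRoot C a}

/-- The index set of the Chevalley basis: `Sum.inl i` stands for `hᵢ`
and `Sum.inr α` stands for the root vector `e_α`. -/
abbrev ChevalleyIndex {n : ℕ} (C : Matrix (Fin n) (Fin n) ℤ) : Type := Fin n ⊕ Root C

/-- The vector space over `k` with basis the Chevalley basis. -/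
def ChevalleyAlgebra (k : Type*) [Field k] {n : ℕ} (C : Matrix (Fin n) (Fin n) ℤ) : Type _ :=
  ChevalleyIndex C →₀ k

namespace ChevalleyAlgebra

noncomputable section

variable (k : Type*) [Field k] {n : ℕ} (C : Matrix (Fin n) (Fin n) ℤ)

instance : AddCommGroup (ChevalleyAlgebra k C) :=
  inferInstanceAs (AddCommGroup (ChevalleyIndex C →₀ k))

instance : Module k (ChevalleyAlgebra k C) :=
  inferInstanceAs (Module k (ChevalleyIndex C →₀ k))

/-- The Chevalley basis. -/
def basis : Module.Basis (ChevalleyIndex C) k (ChevalleyAlgebra k C) :=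
  Finsupp.basisSingleOne

/-- The Cartan element `hᵢ` of the Chevalley basis. -/
def h (i : Fin n) : ChevalleyAlgebra k C := basis k C (Sum.inl i)

variable {C}

/-- The root vector `e_α` of the Chevalley basis. -/
def e (α : Root C) : ChevalleyAlgebra k C := basis k C (Sum.inr α)

/-- `h_α = ∑ aᵢ hᵢ` for the root `α = ∑ aᵢ αᵢ` (the root system being simply laced, the coroot
of `α` is `∑ aᵢ αᵢ^∨`). -/
def coroot (α : Root C) : ChevalleyAlgebra k C := ∑ i, (α.1 i : k) • h k C i

open Classical in
/-- The Lie brackets of the elements of the Chevalley basis in characteristic two: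
* `[hᵢ, hⱼ] = 0`;
* `[hᵢ, e_β] = ⟨β, αᵢ^∨⟩ e_β` and `[e_α, hⱼ] = -⟨α, αⱼ^∨⟩ e_α`;
* `[e_α, e_{-α}] = h_α`;
* `[e_α, e_β] = e_{α + β}` if `α + β` is a root, and `[e_α, e_β] = 0` if `α + β ≠ 0` is not a root.
Over the integers the brackets of the last kind are `±(r + 1) e_{α + β}`, where `r` is the largest
integer such that `β - r α` is a root; here `r = 0` as the root system is simply laced, and the sign
disappears in characteristic two. -/
def bracketBasis : ChevalleyIndex C → ChevalleyIndex C → ChevalleyAlgebra k C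
  | .inl _, .inl _ => 0
  | .inl i, .inr β => (C.mulVec β.1 i : k) • e k β
  | .inr α, .inl j => -((C.mulVec α.1 j : k) • e k α)
  | .inr α, .inr β =>
      if α.1 + β.1 = 0 then coroot k α
      else if hr : IsRoot C (α.1 + β.1) then e k ⟨α.1 + β.1, hr⟩ else 0

variable (C)

/-- The Lie bracket, extended bilinearly from the basis. -/
def bracket : ChevalleyAlgebra k C →ₗ[k] ChevalleyAlgebra k C →ₗ[k] ChevalleyAlgebra k C :=
  (basis k C).constr k fun i => (basis k C).constr k fun j => bracketBasis k i j

variable {C}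

theorem bracket_basis (i j : ChevalleyIndex C) :
    bracket k C (basis k C i) (basis k C j) = bracketBasis k i j := by
  simp [bracket]

theorem form_comm [IsADECartan C] (a b : Fin n → ℤ) :
    dotProduct a (C.mulVec b) = dotProduct b (C.mulVec a) := by
  have hC : C.transpose = C := by
    ext i j
    exact IsADECartan.symm j i
  rw [Matrix.dotProduct_mulVec, ← Matrix.mulVec_transpose, hC, dotProduct_comm]

theorem form_add_self [IsADECartan C] (a b : Fin n → ℤ) :
    dotProduct (a + b) (C.mulVec (a + b)) = dotProduct a (C.mulVec a)
      + dotProduct b (C.mulVec b) + 2 * dotProduct a (C.mulVec b) := by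
  rw [Matrix.mulVec_add, add_dotProduct, dotProduct_add, dotProduct_add, form_comm b a]
  ring

theorem form_nonneg [IsADECartan C] (a : Fin n → ℤ) : 0 ≤ dotProduct a (C.mulVec a) := by
  by_cases ha : a = 0
  · simp [ha]
  · exact (IsADECartan.pos a ha).le

theorem add_eq_zero_iff [IsADECartan C] (α β : Root C) :
    α.1 + β.1 = 0 ↔ dotProduct α.1 (C.mulVec β.1) = -2 := by
  have h1 := form_add_self (C := C) α.1 β.1
  rw [show dotProduct α.1 (C.mulVec α.1) = 2 from α.2,
    show dotProduct β.1 (C.mulVec β.1) = 2 from β.2] at h1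
  constructor
  · intro h0
    rw [h0] at h1
    simp at h1
    linarith
  · intro h0
    by_contra hne
    have := IsADECartan.pos (C := C) _ hne
    linarith

theorem isRoot_add_iff [IsADECartan C] (α β : Root C) :
    IsRoot C (α.1 + β.1) ↔ dotProduct α.1 (C.mulVec β.1) = -1 := by
  have h1 := form_add_self (C := C) α.1 β.1
  rw [show dotProduct α.1 (C.mulVec α.1) = 2 from α.2,
    show dotProduct β.1 (C.mulVec β.1) = 2 from β.2] at h1
  unfold IsRoot
  constructor <;> intro h0 <;> linarith

theorem form_bounds [IsADECartan C] (α β : Root C) :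
    -2 ≤ dotProduct α.1 (C.mulVec β.1) ∧ dotProduct α.1 (C.mulVec β.1) ≤ 2 := by
  have h1 := form_add_self (C := C) α.1 β.1
  have h2 := form_add_self (C := C) α.1 (-β.1)
  have p1 := form_nonneg (C := C) (α.1 + β.1)
  have p2 := form_nonneg (C := C) (α.1 + -β.1)
  rw [show dotProduct α.1 (C.mulVec α.1) = 2 from α.2] at h1 h2
  simp only [Matrix.mulVec_neg, neg_dotProduct, dotProduct_neg, neg_neg] at h2
  rw [show dotProduct β.1 (C.mulVec β.1) = 2 from β.2] at h1 h2
  constructor <;> linarith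

open Classical in
/-- `e_v` if `v` is a root, and `0` otherwise. -/
def eAux (C : Matrix (Fin n) (Fin n) ℤ) (v : Fin n → ℤ) : ChevalleyAlgebra k C :=
  if hr : IsRoot C v then e k ⟨v, hr⟩ else 0

theorem eAux_root (α : Root C) : eAux k C α.1 = e k α := by
  have : IsRoot C α.1 := α.2
  simp only [eAux, this, dif_pos]

theorem bracket_e_e (α β : Root C) : bracket k C (e k α) (e k β) =
    if α.1 + β.1 = 0 then coroot k α else eAux k C (α.1 + β.1) := by
  classical
  rw [e, e, bracket_basis]
  simp only [bracketBasis, eAux]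

theorem bracket_e_h (α : Root C) (j : Fin n) : bracket k C (e k α) (h k C j) =
    -((C.mulVec α.1 j : k) • e k α) := by
  rw [e, h, bracket_basis]
  rfl

theorem bracket_h_e (α : Root C) (j : Fin n) : bracket k C (h k C j) (e k α) =
    (C.mulVec α.1 j : k) • e k α := by
  rw [e, h, bracket_basis]
  rfl

theorem bracket_h_h (i j : Fin n) : bracket k C (h k C i) (h k C j) = 0 := by
  rw [h, h, bracket_basis]
  rfl

theorem bracket_e_coroot [IsADECartan C] (α β : Root C) : bracket k C (e k α) (coroot k β) =
    -((dotProduct α.1 (C.mulVec β.1) : ℤ) : k) • e k α := by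
  rw [form_comm]
  simp only [coroot, map_sum, map_smul, bracket_e_h, dotProduct, Int.cast_sum, Int.cast_mul,
    smul_neg, smul_smul, Finset.sum_neg_distrib, neg_smul, Finset.sum_smul]

theorem bracket_h_coroot (i : Fin n) (β : Root C) :
    bracket k C (h k C i) (coroot k β) = 0 := by
  simp [coroot, bracket_h_h]

theorem coroot_of_add_eq_zero [CharP k 2] {α β : Root C} (h0 : α.1 + β.1 = 0) :
    coroot k α = coroot k β := by
  have : β.1 = -α.1 := (neg_eq_of_add_eq_zero_right h0).symm
  simp [coroot, this, CharTwo.neg_eq]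

theorem neg_eq_self [CharP k 2] (x : ChevalleyAlgebra k C) : -x = x := by
  rw [← neg_one_smul k x, CharTwo.neg_eq, one_smul]

theorem add_self [CharP k 2] (x : ChevalleyAlgebra k C) : x + x = 0 := by
  rw [← two_smul k x, CharTwo.two_eq_zero, zero_smul]

theorem bracketBasis_comm [CharP k 2] (i j : ChevalleyIndex C) :
    bracketBasis k i j = bracketBasis k j i := by
  rcases i with i | α <;> rcases j with j | β
  · rfl
  · exact (neg_eq_self k _).symm
  · exact neg_eq_self k _
  · rw [← bracket_basis, ← bracket_basis]
    change bracket k C (e k α) (e k β) = bracket k C (e k β) (e k α)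
    rw [bracket_e_e, bracket_e_e, add_comm β.1 α.1]
    split_ifs with h0
    · exact coroot_of_add_eq_zero k h0
    · rfl

theorem bracket_comm [CharP k 2] (x y : ChevalleyAlgebra k C) :
    bracket k C x y = bracket k C y x := by
  have : bracket k C = (bracket k C).flip := by
    refine (basis k C).ext fun i => (basis k C).ext fun j => ?_
    rw [LinearMap.flip_apply, bracket_basis, bracket_basis, bracketBasis_comm]
  exact congrArg (fun f => f x y) this

theorem bracketBasis_self [IsADECartan C] (i : ChevalleyIndex C) : bracketBasis k i i = 0 := by
  rcases i with i | α
  · rfl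
  · rw [← bracket_basis]
    change bracket k C (e k α) (e k α) = 0
    have hα : dotProduct α.1 (C.mulVec α.1) = 2 := α.2
    rw [bracket_e_e, if_neg (by rw [add_eq_zero_iff, hα]; decide), eAux,
      dif_neg (by rw [isRoot_add_iff, hα]; decide)]

theorem induction_basis {p : ChevalleyAlgebra k C → Prop} (h0 : p 0)
    (hb : ∀ i, p (basis k C i)) (hadd : ∀ x y, p x → p y → p (x + y))
    (hsmul : ∀ (c : k) x, p x → p (c • x)) (x : ChevalleyAlgebra k C) : p x := by
  refine Submodule.span_induction (p := fun x _ => p x) ?_ h0 (fun x y _ _ => hadd x y)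
    (fun c x _ => hsmul c x) ((basis k C).mem_span x)
  rintro _ ⟨i, rfl⟩
  exact hb i

theorem bracket_self [CharP k 2] [IsADECartan C] (x : ChevalleyAlgebra k C) :
    bracket k C x x = 0 := by
  induction x using induction_basis with
  | h0 => simp
  | hb i => rw [bracket_basis, bracketBasis_self]
  | hadd x y hx hy =>
    simp only [map_add, LinearMap.add_apply, hx, hy, bracket_comm k y x, zero_add, add_zero,
      add_self]
  | hsmul c x hx => simp [hx]

theorem bracket_e_bracket [CharP k 2] [IsADECartan C] (α β γ : Root C)
    (hne : α.1 + β.1 + γ.1 ≠ 0) :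
    bracket k C (e k α) (bracket k C (e k β) (e k γ)) =
      (if dotProduct β.1 (C.mulVec γ.1) = -2 then ((dotProduct α.1 (C.mulVec β.1) : ℤ) : k)
        else if dotProduct β.1 (C.mulVec γ.1) = -1 then 1 else 0) •
        eAux k C (α.1 + β.1 + γ.1) := by
  rw [bracket_e_e]
  simp only [add_eq_zero_iff]
  split_ifs with h1 h2
  · rw [bracket_e_coroot, CharTwo.neg_eq, add_assoc, (add_eq_zero_iff β γ).2 h1, add_zero,
      eAux_root]
  · have hr := (isRoot_add_iff β γ).2 h2
    have h3 := eAux_root k ⟨β.1 + γ.1, hr⟩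
    simp only at h3
    rw [h3, bracket_e_e]
    simp only [← add_assoc]
    rw [if_neg hne, one_smul]
  · rw [eAux, dif_neg (by rwa [isRoot_add_iff]), map_zero, zero_smul]

theorem bracket_e_bracket_of_eq_zero [IsADECartan C] (α β γ : Root C)
    (h0 : α.1 + β.1 + γ.1 = 0) :
    bracket k C (e k α) (bracket k C (e k β) (e k γ)) = coroot k α := by
  have hα : dotProduct α.1 (C.mulVec α.1) = 2 := α.2
  have hβ : dotProduct β.1 (C.mulVec β.1) = 2 := β.2
  have hγ : dotProduct γ.1 (C.mulVec γ.1) = 2 := γ.2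
  have hs : α.1 = -(β.1 + γ.1) := eq_neg_of_add_eq_zero_left (by rw [← add_assoc, h0])
  have h1 := form_add_self (C := C) β.1 γ.1
  have h2 : dotProduct (β.1 + γ.1) (C.mulVec (β.1 + γ.1)) = 2 := by
    rw [hs] at hα
    simpa only [Matrix.mulVec_neg, neg_dotProduct, dotProduct_neg, neg_neg] using hα
  have hbg : dotProduct β.1 (C.mulVec γ.1) = -1 := by linarith
  have hr := (isRoot_add_iff β γ).2 hbg
  rw [bracket_e_e, if_neg (by rw [add_eq_zero_iff, hbg]; decide)]
  have := eAux_root k ⟨β.1 + γ.1, hr⟩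
  simp only at this
  rw [this, bracket_e_e]
  simp only [← add_assoc]
  rw [if_pos h0]

theorem form_add_left (a b c : Fin n → ℤ) :
    dotProduct (a + b) (C.mulVec c) = dotProduct a (C.mulVec c) + dotProduct b (C.mulVec c) :=
  add_dotProduct _ _ _

theorem jacobi_eee [CharP k 2] [IsADECartan C] (α β γ : Root C) :
    bracket k C (e k α) (bracket k C (e k β) (e k γ)) +
      bracket k C (e k β) (bracket k C (e k γ) (e k α)) +
      bracket k C (e k γ) (bracket k C (e k α) (e k β)) = 0 := by
  by_cases h0 : α.1 + β.1 + γ.1 = 0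
  · have h1 : β.1 + γ.1 + α.1 = 0 := by rw [← h0]; abel
    have h2 : γ.1 + α.1 + β.1 = 0 := by rw [← h0]; abel
    rw [bracket_e_bracket_of_eq_zero k _ _ _ h0, bracket_e_bracket_of_eq_zero k _ _ _ h1,
      bracket_e_bracket_of_eq_zero k _ _ _ h2]
    simp only [coroot, ← Finset.sum_add_distrib, ← add_smul]
    refine Finset.sum_eq_zero fun i _ => ?_
    have h3 : α.1 i + β.1 i + γ.1 i = 0 := congrFun h0 i
    rw [← Int.cast_add, ← Int.cast_add, h3, Int.cast_zero, zero_smul]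
  · have e1 : β.1 + γ.1 + α.1 = α.1 + β.1 + γ.1 := by abel
    have e2 : γ.1 + α.1 + β.1 = α.1 + β.1 + γ.1 := by abel
    rw [bracket_e_bracket k _ _ _ h0, bracket_e_bracket k _ _ _ (by rwa [e1]),
      bracket_e_bracket k _ _ _ (by rwa [e2]), e1, e2, ← add_smul, ← add_smul]
    by_cases hr : IsRoot C (α.1 + β.1 + γ.1)
    · have hα : dotProduct α.1 (C.mulVec α.1) = 2 := α.2
      have hβ : dotProduct β.1 (C.mulVec β.1) = 2 := β.2
      have hγ : dotProduct γ.1 (C.mulVec γ.1) = 2 := γ.2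
      have hsum : dotProduct β.1 (C.mulVec γ.1) + dotProduct γ.1 (C.mulVec α.1)
          + dotProduct α.1 (C.mulVec β.1) = -2 := by
        have h1 := form_add_self (C := C) (α.1 + β.1) γ.1
        have h2 := form_add_self (C := C) α.1 β.1
        rw [show dotProduct _ _ = (2 : ℤ) from hr, h2, form_add_left, form_comm α.1 γ.1] at h1
        linarith
      have key : ∀ α β γ : Root C, dotProduct β.1 (C.mulVec γ.1) = -2 →
          dotProduct α.1 (C.mulVec β.1) = - dotProduct γ.1 (C.mulVec α.1) := by
        intro α β γ h1
        rw [form_comm γ.1 α.1,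
          show γ.1 = -β.1 from (neg_eq_of_add_eq_zero_right ((add_eq_zero_iff β γ).2 h1)).symm]
        simp [Matrix.mulVec_neg]
      have k1 := key α β γ
      have k2 := key β γ α
      have k3 := key γ α β
      obtain ⟨a1, a2⟩ := form_bounds β γ
      obtain ⟨b1, b2⟩ := form_bounds γ α
      obtain ⟨c1, c2⟩ := form_bounds α β
      generalize dotProduct β.1 (C.mulVec γ.1) = x at *
      generalize dotProduct γ.1 (C.mulVec α.1) = y at *
      generalize dotProduct α.1 (C.mulVec β.1) = z at *
      have h2 : (2 : ℤ) ∣ (if x = -2 then z else if x = -1 then 1 else 0) +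
          (if y = -2 then x else if y = -1 then 1 else 0) +
          (if z = -2 then y else if z = -1 then 1 else 0) := by
        clear hα hβ hγ key e1 e2 h0 hr
        split_ifs <;> omega
      have h3 := (CharP.intCast_eq_zero_iff k 2 _).2 h2
      push_cast at h3
      rw [h3, zero_smul]
    · rw [eAux, dif_neg hr, smul_zero]

theorem jacobi_basis [CharP k 2] [IsADECartan C] (i j l : ChevalleyIndex C) :
    bracket k C (basis k C i) (bracket k C (basis k C j) (basis k C l)) +
      bracket k C (basis k C j) (bracket k C (basis k C l) (basis k C i)) +
      bracket k C (basis k C l) (bracket k C (basis k C i) (basis k C j)) = 0 := by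
  have hhh : ∀ i j l : Fin n, bracket k C (h k C i) (bracket k C (h k C j) (h k C l)) = 0 := by
    intro i j l
    rw [bracket_h_h, map_zero]
  have hhe : ∀ (i j : Fin n) (α : Root C),
      bracket k C (h k C i) (bracket k C (h k C j) (e k α)) +
      bracket k C (h k C j) (bracket k C (e k α) (h k C i)) +
      bracket k C (e k α) (bracket k C (h k C i) (h k C j)) = 0 := by
    intro i j α
    rw [bracket_h_h, map_zero, bracket_h_e, bracket_e_h, map_neg, map_smul, map_smul, bracket_h_e,
      bracket_h_e, smul_smul, smul_smul, mul_comm]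
    simp
  have hee : ∀ (i : Fin n) (α β : Root C),
      bracket k C (h k C i) (bracket k C (e k α) (e k β)) +
      bracket k C (e k α) (bracket k C (e k β) (h k C i)) +
      bracket k C (e k β) (bracket k C (h k C i) (e k α)) = 0 := by
    intro i α β
    rw [bracket_e_h, bracket_h_e, map_neg, map_smul, map_smul, bracket_comm k (e k β) (e k α),
      neg_eq_self, bracket_e_e, add_assoc, ← add_smul]
    by_cases h0 : α.1 + β.1 = 0
    · rw [if_pos h0, bracket_h_coroot, show β.1 = -α.1 from (neg_eq_of_add_eq_zero_right h0).symm]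
      simp [Matrix.mulVec_neg]
    · rw [if_neg h0]
      by_cases hr : IsRoot C (α.1 + β.1)
      · have := eAux_root k ⟨α.1 + β.1, hr⟩
        simp only at this
        rw [this, bracket_h_e, ← add_smul]
        simp only [Matrix.mulVec_add, Pi.add_apply, Int.cast_add]
        rw [add_comm (C.mulVec β.1 i : k), CharTwo.add_self_eq_zero, zero_smul]
      · rw [eAux, dif_neg hr, map_zero, smul_zero, add_zero]
  rcases i with i | α <;> rcases j with j | β <;> rcases l with l | γ
  · have := hhh i j l
    have := hhh j l i
    have := hhh l i j
    simp_all only [h, add_zero]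
  · exact hhe i j γ
  · have := hhe l i β
    rw [← this, h, h, e]
    abel
  · exact hee i β γ
  · have := hhe j l α
    rw [← this, h, h, e]
    abel
  · have := hee j γ α
    rw [← this, h, e, e]
    abel
  · have := hee l α β
    rw [← this, h, e, e]
    abel
  · exact jacobi_eee k α β γ

theorem jacobi_extend (y z : ChevalleyAlgebra k C)
    (hb : ∀ i, bracket k C (basis k C i) (bracket k C y z) +
      bracket k C y (bracket k C z (basis k C i)) +
      bracket k C z (bracket k C (basis k C i) y) = 0) (x : ChevalleyAlgebra k C) :
    bracket k C x (bracket k C y z) + bracket k C y (bracket k C z x) +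
      bracket k C z (bracket k C x y) = 0 := by
  have : (bracket k C).flip (bracket k C y z) + bracket k C y ∘ₗ bracket k C z +
      bracket k C z ∘ₗ (bracket k C).flip y = 0 :=
    (basis k C).ext fun i => by simpa using hb i
  simpa using congrArg (fun f => f x) this

theorem jacobi [CharP k 2] [IsADECartan C] (x y z : ChevalleyAlgebra k C) :
    bracket k C x (bracket k C y z) + bracket k C y (bracket k C z x) +
      bracket k C z (bracket k C x y) = 0 := by
  refine jacobi_extend k y z (fun i => ?_) x
  rw [add_comm, ← add_assoc]
  refine jacobi_extend k _ _ (fun j => ?_) z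
  rw [add_comm, ← add_assoc]
  refine jacobi_extend k _ _ (fun l => ?_) y
  exact jacobi_basis k l j i

instance [CharP k 2] [IsADECartan C] : LieRing (ChevalleyAlgebra k C) where
  bracket x y := bracket k C x y
  add_lie x y z := by
    change bracket k C (x + y) z = _
    rw [map_add]
    rfl
  lie_add x y z := (bracket k C x).map_add y z
  lie_self x := bracket_self k x
  leibniz_lie x y z := by
    change bracket k C x (bracket k C y z) =
      bracket k C (bracket k C x y) z + bracket k C y (bracket k C x z)
    have h1 := jacobi k x y z
    rw [bracket_comm k z x, bracket_comm k z (bracket k C x y), add_assoc] at h1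
    rw [add_comm (bracket k C (bracket k C x y) z), eq_neg_of_add_eq_zero_left h1, neg_eq_self]

instance [CharP k 2] [IsADECartan C] : LieAlgebra k (ChevalleyAlgebra k C) where
  lie_smul c x y := (bracket k C x).map_smul c y

theorem lie_def [CharP k 2] [IsADECartan C] (x y : ChevalleyAlgebra k C) :
    ⁅x, y⁆ = bracket k C x y := rfl

/-- The simple root `αᵢ`. -/
def simpleRoot [IsADECartan C] (i : Fin n) : Root C :=
  ⟨Pi.single i 1, by simp [IsRoot, IsADECartan.diag]⟩

/-- The root `-α`. -/
def negRoot (α : Root C) : Root C :=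
  ⟨-α.1, by
    have := α.2
    unfold IsRoot at this ⊢
    simpa only [Matrix.mulVec_neg, neg_dotProduct, dotProduct_neg, neg_neg] using this⟩

section Group

variable [CharP k 2] [IsADECartan C]

/-- The linear map `x_α(t) = exp(t ad e_α) = 1 + t ad e_α + t² (ad e_α)² / 2`, by which the element
`x_α(t)` of the root subgroup of `α` acts in the adjoint representation. The divided square
`(ad e_α)² / 2` of the integral form maps `e_{-α}` to `-e_α` and all other elements of the
Chevalley basis to `0`. -/
def rootEnd (α : Root C) (t : k) : Module.End k (ChevalleyAlgebra k C) :=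
  LinearMap.id + t • bracket k C (e k α) -
    t ^ 2 • ((basis k C).coord (Sum.inr (negRoot α))).smulRight (e k α)

theorem rootEnd_apply (α : Root C) (t : k) (x : ChevalleyAlgebra k C) :
    rootEnd k α t x = x + t • ⁅e k α, x⁆ -
      (t ^ 2 * (basis k C).repr x (Sum.inr (negRoot α))) • e k α := by
  simp [rootEnd, lie_def, smul_smul]

theorem bracket_e_e_apply (α : Root C) (x : ChevalleyAlgebra k C) :
    bracket k C (e k α) (bracket k C (e k α) x) = 0 := by
  have hα : dotProduct α.1 (C.mulVec α.1) = 2 := α.2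
  have hself : bracket k C (e k α) (e k α) = 0 := bracket_self k _
  have : bracket k C (e k α) ∘ₗ bracket k C (e k α) = 0 := by
    refine (basis k C).ext fun i => ?_
    rw [LinearMap.comp_apply, LinearMap.zero_apply]
    rcases i with i | β
    · change bracket k C (e k α) (bracket k C (e k α) (h k C i)) = 0
      rw [bracket_e_h, map_neg, map_smul, hself, smul_zero, neg_zero]
    · change bracket k C (e k α) (bracket k C (e k α) (e k β)) = 0
      rw [bracket_e_e]
      split_ifs with h0
      · rw [bracket_e_coroot, hα]
        simp [CharTwo.two_eq_zero]
      · by_cases hr : IsRoot C (α.1 + β.1)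
        · have h3 := eAux_root k ⟨α.1 + β.1, hr⟩
          simp only at h3
          have h4 : dotProduct α.1 (C.mulVec (α.1 + β.1)) = 1 := by
            rw [Matrix.mulVec_add, dotProduct_add, hα, (isRoot_add_iff α β).1 hr]
            rfl
          have h5 := add_eq_zero_iff α ⟨α.1 + β.1, hr⟩
          have h6 := isRoot_add_iff α ⟨α.1 + β.1, hr⟩
          simp only [h4] at h5 h6
          rw [h3, bracket_e_e, if_neg (by rw [h5]; decide), eAux, dif_neg (by rw [h6]; decide)]
        · rw [eAux, dif_neg hr, map_zero]
  exact congrArg (fun f => f x) this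

theorem negRoot_ne (α : Root C) : α ≠ negRoot α := by
  intro h0
  have hα : dotProduct α.1 (C.mulVec α.1) = 2 := α.2
  have h1 : α.1 + α.1 = 0 := by
    nth_rewrite 2 [h0]
    simp [negRoot]
  rw [add_eq_zero_iff, hα] at h1
  exact absurd h1 (by decide)

theorem repr_e_negRoot (α : Root C) :
    (basis k C).repr (e k α) (Sum.inr (negRoot α)) = 0 := by
  rw [e, Module.Basis.repr_self, Finsupp.single_eq_of_ne]
  intro h0
  exact negRoot_ne α (Sum.inr_injective h0).symm

theorem repr_bracket_negRoot (α : Root C) (x : ChevalleyAlgebra k C) :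
    (basis k C).repr (bracket k C (e k α) x) (Sum.inr (negRoot α)) = 0 := by
  have : (basis k C).coord (Sum.inr (negRoot α)) ∘ₗ bracket k C (e k α) = 0 := by
    refine (basis k C).ext fun i => ?_
    rw [LinearMap.comp_apply, LinearMap.zero_apply, Module.Basis.coord_apply]
    rcases i with i | β
    · change (basis k C).repr (bracket k C (e k α) (h k C i)) _ = 0
      rw [bracket_e_h, map_neg, map_smul, Finsupp.neg_apply, Finsupp.smul_apply, repr_e_negRoot,
        smul_zero, neg_zero]
    · change (basis k C).repr (bracket k C (e k α) (e k β)) _ = 0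
      rw [bracket_e_e]
      split_ifs with h0
      · simp [coroot, h]
      · by_cases hr : IsRoot C (α.1 + β.1)
        · have h3 := eAux_root k ⟨α.1 + β.1, hr⟩
          simp only at h3
          rw [h3, e, Module.Basis.repr_self, Finsupp.single_eq_of_ne]
          intro h4
          have h5 : -α.1 = α.1 + β.1 := congrArg Subtype.val (Sum.inr_injective h4)
          have hα : dotProduct α.1 (C.mulVec α.1) = 2 := α.2
          have h6 : dotProduct α.1 (C.mulVec (-α.1)) = dotProduct α.1 (C.mulVec (α.1 + β.1)) := by
            rw [h5]
          rw [Matrix.mulVec_neg, dotProduct_neg, Matrix.mulVec_add, dotProduct_add, hα,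
            (isRoot_add_iff α β).1 hr] at h6
          exact absurd h6 (by decide)
        · rw [eAux, dif_neg hr]
          simp
  exact congrArg (fun f => f x) this

theorem rootEnd_rootEnd (α : Root C) (t : k) (x : ChevalleyAlgebra k C) :
    rootEnd k α t (rootEnd k α t x) = x := by
  have hself : bracket k C (e k α) (e k α) = 0 := bracket_self k _
  simp only [rootEnd_apply, lie_def, map_add, map_sub, map_smul, hself, bracket_e_e_apply,
    repr_bracket_negRoot, repr_e_negRoot, smul_zero, mul_zero, zero_smul, add_zero, sub_zero]
  have h1 := add_self k (t • bracket k C (e k α) x)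
  have h2 := add_self k ((t ^ 2 * (basis k C).repr x (Sum.inr (negRoot α))) • e k α)
  rw [sub_eq_add_neg, sub_eq_add_neg, neg_eq_self]
  have h3 : ∀ a b c : ChevalleyAlgebra k C, a + b + c + b + c = a + (b + b) + (c + c) := by
    intro a b c
    abel
  rw [h3, h1, h2, add_zero, add_zero]

/-- The action of `x_α(t)` as an invertible linear map; in characteristic two it is an involution,
`x_α(t)⁻¹ = x_α(-t) = x_α(t)`. -/
def rootElement (α : Root C) (t : k) : ChevalleyAlgebra k C ≃ₗ[k] ChevalleyAlgebra k C :=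
  LinearEquiv.ofInvolutive (rootEnd k α t) (rootEnd_rootEnd k α t)

variable (C)

/-- The image `Ad(G)` of the group `G` of points over `k` of the Chevalley group in the general
linear group of its Lie algebra. For algebraically closed `k` the group `G` is generated by its
root subgroups. -/
def adjointGroup : Subgroup (ChevalleyAlgebra k C ≃ₗ[k] ChevalleyAlgebra k C) :=
  Subgroup.closure {φ | ∃ (α : Root C) (t : k), φ = rootElement k α t}

variable {C}

/-- The orbit of an element of the Lie algebra under the adjoint action of `G`. -/
def adjointOrbit (x : ChevalleyAlgebra k C) : Set (ChevalleyAlgebra k C) :=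
  {y | ∃ φ ∈ adjointGroup k C, y = φ x}

variable (C)

/-- The nilpotent element `e_{αᵢ} + e_{αⱼ} + e_{αₗ}`. -/
def sumSimple (i j l : Fin n) : ChevalleyAlgebra k C :=
  e k (simpleRoot i) + e k (simpleRoot j) + e k (simpleRoot l)

end Group

end

end ChevalleyAlgebra

section Subalgebras

variable {k : Type*} [Field k] {L : Type*} [LieRing L] [LieAlgebra k L]

/-- The normaliser `𝔫_x = {y | [y, x] ∈ k x}` of (the line spanned by) an element `x`. -/
def elementNormalizer (x : L) : LieSubalgebra k L where
  carrier := {y | ∃ c : k, ⁅y, x⁆ = c • x}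
  zero_mem' := ⟨0, by simp⟩
  add_mem' := by
    rintro y z ⟨c, hc⟩ ⟨d, hd⟩
    exact ⟨c + d, by rw [add_lie, hc, hd, add_smul]⟩
  smul_mem' := by
    rintro a y ⟨c, hc⟩
    exact ⟨a * c, by rw [smul_lie, hc, smul_smul]⟩
  lie_mem' := by
    rintro y z ⟨c, hc⟩ ⟨d, hd⟩
    exact ⟨0, by rw [lie_lie, hc, hd, lie_smul, lie_smul, hc, hd, smul_smul, smul_smul, mul_comm,
      sub_self, zero_smul]⟩

/-- The solvable radical of the normaliser of `x`, as a subalgebra of `L`. -/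
def radicalOfNormalizer (x : L) : LieSubalgebra k L :=
  (LieIdeal.toLieSubalgebra k _ (LieAlgebra.radical k (elementNormalizer (k := k) x))).map
    (elementNormalizer (k := k) x).incl

/-- The normaliser in `L` of the radical of the normaliser of `x`. -/
def normalizerOfRadical (x : L) : LieSubalgebra k L :=
  (radicalOfNormalizer (k := k) x).normalizer

end Subalgebras

/-! ## Gaussian elimination over `𝔽₂` on bitmasks, and its consequences over fields of
characteristic two -/

/-! In characteristic two the structure constants of the Chevalley basis are 0 or 1, and all
elements that matter are sums of basis vectors. The spans and kernels involved are therefore defined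
over the prime field: Gaussian elimination over 𝔽₂ finds them, and the answer stays correct over `k`
(`mem_spanList_eliminate`). The adjoint group acts by Lie algebra automorphisms (`rootEnd_lie`), so
a computation for `e = e_{α₁} + e_{α₄} + e_{α₆}` settles the whole orbit, after the basis has been
moved by the automorphism.

Radical. Let `A` be spanned by `e`, two root vectors and, for `E₇`, the central element `h₂ + h₅ +
h₇`. It is abelian, and the elimination shows that `M = {x | [e, x] ∈ A}` normalises it. Since `𝔫_e
⊆ M`, `A` is an abelian ideal of `𝔫_e` and lies in the radical `R`. Suppose `R ≠ A`. The basis is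
ordered by a linear functional on the root lattice, with the Cartan elements in the middle, and `ad`
of certain elements of `𝔫_e` strictly raises the resulting flag. An element of `R` outside `A` lying
as deep as possible in the flag is mapped into `A` by these operators (`exists_map_mem`). Modulo `A`
their common kernel in `M` is spanned by the last basis vector, a root vector, so `R` contains it.
Its brackets with `𝔫_e` and with one another yield six sums of root vectors forming a hexagon in
which each is the bracket of its two neighbours, as for the root vectors of `𝔰𝔩₃`. They lie in every
term of the derived series of `R` and are not all zero, which contradicts solvability
(`eq_zero_of_mem_solvable`). So `R = A` and the normaliser of `R` is `M`, whose dimension is the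
length of an echelon basis.

Maximality. Let `N` strictly contain `M`. The same flag argument, now modulo `M` and with raising
operators from `M`, puts one specific root vector into `N`. Its brackets with `M` and with one
another produce, together with `M`, all `e_{±αᵢ}`, and these generate the Lie algebra
(`eq_top_of_simple_mem`).

The choices (operators, words, hexagon) are recorded in a `Certificate`. The general theory turns
Boolean checks of a certificate into the theorem, and the checks are evaluated for the three types.
-/

namespace BitMask

/-- Evaluates `f n`, forcing `n` to be reduced to a numeral first. -/
def force {α : Type*} (n : ℕ) (f : ℕ → α) : α :=
  match n with
  | 0 => f 0
  | m + 1 => f (Nat.succ m)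

@[simp] theorem force_eq {α : Type*} (n : ℕ) (f : ℕ → α) : force n f = f n := by
  cases n <;> rfl

/-- Evaluates `f l`, forcing all entries of `l` to be reduced to numerals first. -/
def forceList {α : Type*} : List ℕ → (List ℕ → α) → α
  | [], f => f []
  | a :: l, f => force a fun a' => forceList l fun l' => f (a' :: l')

@[simp] theorem forceList_eq {α : Type*} (l : List ℕ) (f : List ℕ → α) : forceList l f = f l := by
  induction l generalizing f with
  | nil => rfl
  | cons a l ih => simp [forceList, ih]

/-- Reduction of a bitmask modulo a list of pairs of a pivot and a bitmask. -/
def reduce (E : List (ℕ × ℕ)) (u : ℕ) : ℕ :=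
  List.rec u (fun p _ v => force v fun v =>
    cond (Nat.beq (Nat.land 1 (Nat.shiftRight v p.1)) 0) v (Nat.xor v p.2)) E

/-- Those combinations of the bitmasks `us`, found by Gaussian elimination starting from the
pivots `E`, whose bits from `a` on vanish; here the bits are taken modulo `P`, a power of two. -/
def eliminateAux (a P : ℕ) (us : List ℕ) : List (ℕ × ℕ) → List ℕ :=
  List.rec (fun _ => []) (fun u _ ih E => force (reduce E u) fun v =>
    cond (Nat.beq (Nat.mod (Nat.shiftRight v a) P) 0) (v :: ih E)
      (force (Nat.add a (Nat.log2 (Nat.mod (Nat.shiftRight v a) P))) fun l => ih ((l, v) :: E))) us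

/-- Those combinations of the bitmasks `us`, found by Gaussian elimination, for which the `N` bits
from `a` on vanish. -/
def eliminate (a N : ℕ) (us : List ℕ) : List ℕ :=
  forceList us fun us => force a fun a => force (2 ^ N) fun P => eliminateAux a P us []

/-- The list of pairs is an echelon form with pivots at least `a` and below `a + N`. -/
def isEchelon (a N : ℕ) : List (ℕ × ℕ) → Bool
  | [] => true
  | p :: E => Nat.ble a p.1 && Nat.blt p.1 (a + N) && p.2.testBit p.1 &&
      E.all (fun q => !p.2.testBit q.1) && isEchelon a N E

theorem isEchelon_cons {a N : ℕ} {p : ℕ × ℕ} {E : List (ℕ × ℕ)} :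
    isEchelon a N (p :: E) = true ↔ (a ≤ p.1 ∧ p.1 < a + N) ∧ p.2.testBit p.1 = true ∧
      (∀ q ∈ E, p.2.testBit q.1 = false) ∧ isEchelon a N E = true := by
  simp only [isEchelon, Bool.and_eq_true, Nat.ble_eq, Nat.blt_eq, List.all_eq_true,
    Bool.not_eq_true', and_assoc]

theorem lt_of_isEchelon {a N : ℕ} {E : List (ℕ × ℕ)} (hE : isEchelon a N E = true) :
    ∀ q ∈ E, a ≤ q.1 ∧ q.1 < a + N := by
  induction E with
  | nil => simp
  | cons p E ih =>
    obtain ⟨hp, -, -, h3⟩ := isEchelon_cons.1 hE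
    intro q hq
    rcases List.mem_cons.1 hq with rfl | hq
    · exact hp
    · exact ih h3 q hq

theorem reduce_cons (p : ℕ × ℕ) (E : List (ℕ × ℕ)) (u : ℕ) :
    reduce (p :: E) u =
      if (reduce E u).testBit p.1 then reduce E u ^^^ p.2 else reduce E u := by
  change (force (reduce E u) fun v =>
    cond (Nat.beq (Nat.land 1 (Nat.shiftRight v p.1)) 0) v (Nat.xor v p.2)) = _
  have hne : ∀ n : ℕ, (n != 0) = !(Nat.beq n 0) := fun n => by cases n <;> rfl
  have h : (reduce E u).testBit p.1 =
      !(Nat.beq (Nat.land 1 (Nat.shiftRight (reduce E u) p.1)) 0) := hne _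
  rw [force_eq, h]
  cases Nat.beq (Nat.land 1 (Nat.shiftRight (reduce E u) p.1)) 0 <;> rfl

/-- The head of an echelon form vanishes at the pivots of the tail. Since `reduce` treats the tail
first, subtracting the head does not disturb the bits already cleared. -/
theorem testBit_reduce {a N : ℕ} {E : List (ℕ × ℕ)}
    (hE : isEchelon a N E = true) (u : ℕ) :
    ∀ q ∈ E, (reduce E u).testBit q.1 = false := by
  induction E with
  | nil => simp
  | cons p E ih =>
    obtain ⟨-, h1, h2, h3⟩ := isEchelon_cons.1 hE
    intro q hq
    rw [reduce_cons]
    rcases List.mem_cons.1 hq with rfl | hq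
    · split_ifs with h
      · rw [Nat.testBit_xor, h, h1]
        rfl
      · simpa using h
    · split_ifs with h
      · rw [Nat.testBit_xor, ih h3 q hq, h2 q hq]
        rfl
      · exact ih h3 q hq

theorem reduce_eq_self {E : List (ℕ × ℕ)} {u : ℕ} (h : ∀ q ∈ E, u.testBit q.1 = false) :
    reduce E u = u := by
  induction E with
  | nil => rfl
  | cons p E ih =>
    rw [reduce_cons, ih fun q hq => h q (List.mem_cons_of_mem _ hq), h p List.mem_cons_self]
    rfl

section Span

variable {k : Type*} [Field k] {V : Type*} [AddCommGroup V] [Module k V]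

/-- The span of the vectors represented by a list of bitmasks. -/
def spanList (k : Type*) [Field k] {V : Type*} [AddCommGroup V] [Module k V] (X : ℕ → V)
    (l : List ℕ) : Submodule k V :=
  Submodule.span k {x | ∃ u ∈ l, x = X u}

variable {X : ℕ → V} {φ : ℕ → V →ₗ[k] k} {S : ℕ → Prop}

theorem mem_spanList {l : List ℕ} {u : ℕ} (hu : u ∈ l) : X u ∈ spanList k X l :=
  Submodule.subset_span ⟨u, hu, rfl⟩

theorem spanList_le {l : List ℕ} {W : Submodule k V} :
    spanList k X l ≤ W ↔ ∀ u ∈ l, X u ∈ W := by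
  rw [spanList, Submodule.span_le]
  constructor
  · intro h u hu
    exact h ⟨u, hu, rfl⟩
  · rintro h _ ⟨u, hu, rfl⟩
    exact h u hu

theorem spanList_mono {l l' : List ℕ} (h : ∀ u ∈ l, u ∈ l') :
    spanList k X l ≤ spanList k X l' :=
  spanList_le.2 fun u hu => mem_spanList (h u hu)

theorem spanList_nil : spanList k X [] = ⊥ :=
  le_bot_iff.1 (spanList_le.2 (by simp))

theorem spanList_cons (u : ℕ) (l : List ℕ) :
    spanList k X (u :: l) = Submodule.span k {X u} ⊔ spanList k X l := by
  apply le_antisymm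
  · rw [spanList_le]
    intro v hv
    rcases List.mem_cons.1 hv with rfl | hv
    · exact Submodule.mem_sup_left (Submodule.mem_span_singleton_self _)
    · exact Submodule.mem_sup_right (mem_spanList hv)
  · refine sup_le ?_ (spanList_mono fun v hv => List.mem_cons_of_mem _ hv)
    rw [Submodule.span_singleton_le_iff_mem]
    exact mem_spanList List.mem_cons_self

theorem mem_spanList_cons {u : ℕ} {l : List ℕ} {x : V} :
    x ∈ spanList k X (u :: l) ↔ ∃ c : k, ∃ y ∈ spanList k X l, x = c • X u + y := by
  rw [spanList_cons, Submodule.mem_sup]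
  simp only [Submodule.mem_span_singleton]
  constructor
  · rintro ⟨_, ⟨c, rfl⟩, z, hz, rfl⟩
    exact ⟨c, z, hz, rfl⟩
  · rintro ⟨c, y, hy, rfl⟩
    exact ⟨_, ⟨c, rfl⟩, y, hy, rfl⟩

/-- The functionals `φ l` with `S l` read off the bits of `u` from the vector represented by `u`. -/
def Reads (X : ℕ → V) (φ : ℕ → V →ₗ[k] k) (S : ℕ → Prop) (u : ℕ) : Prop :=
  ∀ l, S l → φ l (X u) = if u.testBit l then 1 else 0

theorem Reads.xor [CharP k 2] (hX : ∀ u v, X (u ^^^ v) = X u + X v) {u v : ℕ}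
    (hu : Reads X φ S u) (hv : Reads X φ S v) : Reads X φ S (u ^^^ v) := by
  intro l hl
  rw [hX, map_add, hu l hl, hv l hl, Nat.testBit_xor]
  cases u.testBit l <;> cases v.testBit l <;> simp [CharTwo.add_self_eq_zero]

theorem Reads.reduce [CharP k 2] (hX : ∀ u v, X (u ^^^ v) = X u + X v) {u : ℕ}
    {E : List (ℕ × ℕ)} (hu : Reads X φ S u) (hE : ∀ p ∈ E, Reads X φ S p.2) :
    Reads X φ S (reduce E u) := by
  induction E with
  | nil => exact hu
  | cons p E ih =>
    have ih := ih fun p hp => hE p (List.mem_cons_of_mem _ hp)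
    rw [reduce_cons]
    split_ifs
    · exact ih.xor hX (hE p List.mem_cons_self)
    · exact ih

theorem exists_reduce (hX : ∀ u v, X (u ^^^ v) = X u + X v) (E : List (ℕ × ℕ)) (u : ℕ) :
    ∃ y ∈ spanList k X (E.map Prod.snd), X u = X (reduce E u) + y := by
  induction E with
  | nil => exact ⟨0, Submodule.zero_mem _, by simp [reduce]⟩
  | cons p E ih =>
    obtain ⟨y, hy, h⟩ := ih
    have hy' : y ∈ spanList k X ((p :: E).map Prod.snd) :=
      spanList_mono (by simp +contextual) hy
    rw [reduce_cons]
    split_ifs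
    · refine ⟨y - X p.2, Submodule.sub_mem _ hy' (mem_spanList (by simp)), ?_⟩
      rw [h, hX]
      abel
    · exact ⟨y, hy', h⟩

/-- Triangularity: the pivot functionals of the tail do not see the head, so they force the tail
part of the combination to vanish, and the pivot of the head then kills the remaining coefficient.
The coefficients are in `k`, although the vectors come from bitmasks. -/
theorem eq_zero_of_isEchelon {a N : ℕ} {E : List (ℕ × ℕ)} (hE : isEchelon a N E = true)
    (hR : ∀ p ∈ E, Reads X φ (fun l => a ≤ l ∧ l < a + N) p.2) {x : V}
    (hx : x ∈ spanList k X (E.map Prod.snd))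
    (h0 : ∀ q ∈ E, φ q.1 x = 0) : x = 0 := by
  induction E generalizing x with
  | nil =>
    rw [List.map_nil, spanList_nil] at hx
    exact hx
  | cons p E ih =>
    obtain ⟨hp, h1, h2, h3⟩ := isEchelon_cons.1 hE
    rw [List.map_cons, mem_spanList_cons] at hx
    obtain ⟨c, y, hy, rfl⟩ := hx
    have hy0 : y = 0 := by
      refine ih h3 (fun q hq => hR q (List.mem_cons_of_mem _ hq)) hy fun q hq => ?_
      have := h0 q (List.mem_cons_of_mem _ hq)
      rwa [map_add, map_smul, hR p List.mem_cons_self q.1 (lt_of_isEchelon h3 q hq), h2 q hq,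
        if_neg (by simp), smul_zero, zero_add] at this
    have := h0 p List.mem_cons_self
    rw [hy0, add_zero, map_smul, hR p List.mem_cons_self p.1 hp, h1, if_pos rfl, smul_eq_mul,
      mul_one] at this
    rw [this, hy0, zero_smul, add_zero]

theorem finrank_spanList_of_isEchelon {a N : ℕ} {E : List (ℕ × ℕ)} (hE : isEchelon a N E = true)
    (hR : ∀ p ∈ E, Reads X φ (fun l => a ≤ l ∧ l < a + N) p.2) :
    Module.Finite k (spanList k X (E.map Prod.snd)) ∧
      Module.finrank k (spanList k X (E.map Prod.snd)) = E.length := by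
  induction E with
  | nil =>
    rw [List.map_nil, spanList_nil]
    exact ⟨inferInstance, finrank_bot k V⟩
  | cons p E ih =>
    obtain ⟨hp, h1, h2, h3⟩ := isEchelon_cons.1 hE
    have hR' : ∀ q ∈ E, Reads X φ (fun l => a ≤ l ∧ l < a + N) q.2 :=
      fun q hq => hR q (List.mem_cons_of_mem _ hq)
    obtain ⟨hfin, hrank⟩ := ih h3 hR'
    rw [List.map_cons, spanList_cons]
    have hne : X p.2 ≠ 0 := by
      intro h
      have := hR p List.mem_cons_self p.1 hp
      rw [h, map_zero, h1, if_pos rfl] at this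
      exact zero_ne_one this
    have hnot : X p.2 ∉ spanList k X (E.map Prod.snd) := fun hmem =>
      hne (eq_zero_of_isEchelon h3 hR' hmem fun q hq => by
        rw [hR p List.mem_cons_self q.1 (lt_of_isEchelon h3 q hq), h2 q hq, if_neg (by simp)])
    have hdisj := (Submodule.disjoint_span_singleton' hne).2 hnot
    refine ⟨inferInstance, ?_⟩
    have h4 := Submodule.finrank_sup_add_finrank_inf_eq (Submodule.span k {X p.2})
      (spanList k X (E.map Prod.snd))
    rw [hdisj.symm.eq_bot, finrank_bot, finrank_span_singleton hne, hrank] at h4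
    rw [List.length_cons]
    omega

theorem eliminateAux_cons (a N u : ℕ) (us : List ℕ) (E : List (ℕ × ℕ)) :
    eliminateAux a (2 ^ N) (u :: us) E =
      if (reduce E u >>> a) % 2 ^ N = 0 then reduce E u :: eliminateAux a (2 ^ N) us E
      else eliminateAux a (2 ^ N) us
        ((a + ((reduce E u >>> a) % 2 ^ N).log2, reduce E u) :: E) := by
  change (force (reduce E u) fun v =>
    cond (Nat.beq ((v >>> a) % 2 ^ N) 0) (v :: eliminateAux a (2 ^ N) us E)
      (force (a + Nat.log2 ((v >>> a) % 2 ^ N)) fun l =>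
        eliminateAux a (2 ^ N) us ((l, v) :: E))) = _
  simp only [force_eq]
  split_ifs with h
  · rw [h]
    rfl
  · rw [show Nat.beq ((reduce E u >>> a) % 2 ^ N) 0 = false from
      Bool.eq_false_iff.2 fun h0 => h (Nat.eq_of_beq_eq_true h0)]
    rfl

theorem eliminate_eq (a N : ℕ) (us : List ℕ) :
    eliminate a N us = eliminateAux a (2 ^ N) us [] := by
  simp [eliminate]

theorem testBit_eq_false_of_window {a N u : ℕ} (h : (u >>> a) % 2 ^ N = 0) {l : ℕ}
    (hl : a ≤ l ∧ l < a + N) : u.testBit l = false := by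
  have := Nat.testBit_mod_two_pow (u >>> a) N (l - a)
  rw [h, Nat.zero_testBit, Nat.testBit_shiftRight, Nat.add_sub_cancel' hl.1] at this
  have h1 : l - a < N := by omega
  simpa [h1] using this.symm

/-- The new pivot is the leading bit inside the window, and the reduced vector vanishes at all old
pivots. -/
theorem isEchelon_insert {a N u : ℕ} {E : List (ℕ × ℕ)} (hE : isEchelon a N E = true)
    (h : (reduce E u >>> a) % 2 ^ N ≠ 0) :
    isEchelon a N ((a + ((reduce E u >>> a) % 2 ^ N).log2, reduce E u) :: E) = true := by
  have hlt : ((reduce E u >>> a) % 2 ^ N).log2 < N :=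
    (Nat.log2_lt h).2 (Nat.mod_lt _ (by positivity))
  have hb := Nat.testBit_log2 h
  rw [Nat.testBit_mod_two_pow, Bool.and_eq_true, Nat.testBit_shiftRight] at hb
  exact isEchelon_cons.2 ⟨⟨Nat.le_add_right _ _, Nat.add_lt_add_left hlt _⟩, hb.2,
    testBit_reduce hE u, hE⟩

/-- Each output is a sum of inputs, so its bits still describe the values of the functionals, also
of those outside the window on which the elimination is performed. -/
theorem reads_of_mem_eliminateAux [CharP k 2] (hX : ∀ u v, X (u ^^^ v) = X u + X v) {a N : ℕ}
    {us : List ℕ} {E : List (ℕ × ℕ)} (hu : ∀ u ∈ us, Reads X φ S u)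
    (hE : ∀ p ∈ E, Reads X φ S p.2) : ∀ u ∈ eliminateAux a (2 ^ N) us E, Reads X φ S u := by
  induction us generalizing E with
  | nil => simp [eliminateAux]
  | cons u us ih =>
    have h1 := (hu u List.mem_cons_self).reduce hX hE
    have h2 : ∀ u ∈ us, Reads X φ S u := fun v hv => hu v (List.mem_cons_of_mem _ hv)
    rw [eliminateAux_cons]
    split_ifs
    · intro v hv
      rcases List.mem_cons.1 hv with rfl | hv
      · exact h1
      · exact ih h2 hE v hv
    · refine ih h2 fun p hp => ?_
      rcases List.mem_cons.1 hp with rfl | hp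
      · exact h1
      · exact hE p hp

theorem reads_of_mem_eliminate [CharP k 2] (hX : ∀ u v, X (u ^^^ v) = X u + X v) {a N : ℕ}
    {us : List ℕ} (hu : ∀ u ∈ us, Reads X φ S u) : ∀ u ∈ eliminate a N us, Reads X φ S u := by
  rw [eliminate_eq]
  exact reads_of_mem_eliminateAux hX hu (by simp)

/-- Completeness of the elimination over `k`. The invariant is that `x` lies in the span of the
pending vectors and the pivots. At the end only pivots are left, and triangularity makes a
combination of pivots that is invisible in the window zero. -/
theorem mem_spanList_eliminateAux [CharP k 2] (hX : ∀ u v, X (u ^^^ v) = X u + X v) {a N : ℕ}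
    {us : List ℕ} {E : List (ℕ × ℕ)} (hE : isEchelon a N E = true)
    (hu : ∀ u ∈ us, Reads X φ (fun l => a ≤ l ∧ l < a + N) u)
    (hR : ∀ p ∈ E, Reads X φ (fun l => a ≤ l ∧ l < a + N) p.2) {x : V}
    (hx : x ∈ spanList k X us ⊔ spanList k X (E.map Prod.snd))
    (h0 : ∀ l, a ≤ l ∧ l < a + N → φ l x = 0) :
    x ∈ spanList k X (eliminateAux a (2 ^ N) us E) := by
  induction us generalizing E x with
  | nil =>
    rw [spanList_nil, bot_sup_eq] at hx
    have hx0 : x = 0 :=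
      eq_zero_of_isEchelon hE hR hx fun q hq => h0 _ (lt_of_isEchelon hE q hq)
    rw [hx0]
    exact Submodule.zero_mem _
  | cons u us ih =>
    have h1 := (hu u List.mem_cons_self).reduce hX hR
    have h2 : ∀ u ∈ us, Reads X φ (fun l => a ≤ l ∧ l < a + N) u :=
      fun v hv => hu v (List.mem_cons_of_mem _ hv)
    obtain ⟨y, hy, hXu⟩ := exists_reduce (k := k) hX E u
    obtain ⟨d, hd, b, hb, rfl⟩ := Submodule.mem_sup.1 hx
    obtain ⟨c, z, hz, rfl⟩ := mem_spanList_cons.1 hd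
    have hdecomp : c • X u + z + b = c • X (reduce E u) + (z + (c • y + b)) := by
      rw [hXu, smul_add]
      abel
    have hrest : z + (c • y + b) ∈ spanList k X us ⊔ spanList k X (E.map Prod.snd) :=
      Submodule.add_mem_sup hz (Submodule.add_mem _ (Submodule.smul_mem _ _ hy) hb)
    rw [hdecomp] at h0 ⊢
    rw [eliminateAux_cons]
    -- A reduced vector that vanishes on the window is an output and can be split off without
    -- affecting the functionals; any other vector joins the pivots.
    split_ifs with hw
    · rw [mem_spanList_cons]
      refine ⟨c, _, ih hE h2 hR hrest fun l hl => ?_, rfl⟩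
      have hbit := testBit_eq_false_of_window hw hl
      have := h0 l hl
      rwa [map_add, map_smul, h1 l hl, hbit, if_neg (by simp), smul_zero, zero_add] at this
    · refine ih (isEchelon_insert hE hw) h2 (fun p hp => ?_) ?_ h0
      · rcases List.mem_cons.1 hp with rfl | hp
        · exact h1
        · exact hR p hp
      · rw [List.map_cons, spanList_cons, sup_left_comm]
        exact Submodule.add_mem_sup (Submodule.smul_mem _ _ (Submodule.mem_span_singleton_self _))
          hrest

theorem mem_spanList_eliminate [CharP k 2] (hX : ∀ u v, X (u ^^^ v) = X u + X v) {a N : ℕ}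
    {us : List ℕ} (hu : ∀ u ∈ us, Reads X φ (fun l => a ≤ l ∧ l < a + N) u) {x : V}
    (hx : x ∈ spanList k X us) (h0 : ∀ l, a ≤ l ∧ l < a + N → φ l x = 0) :
    x ∈ spanList k X (eliminate a N us) := by
  rw [eliminate_eq]
  exact mem_spanList_eliminateAux hX rfl hu (by simp) (Submodule.mem_sup_left hx) h0

/-- The projection along the span of an echelon form. -/
def reduceLin (X : ℕ → V) (φ : ℕ → V →ₗ[k] k) : List (ℕ × ℕ) → V →ₗ[k] V
  | [] => LinearMap.id
  | p :: E => (LinearMap.id - (φ p.1).smulRight (X p.2)) ∘ₗ reduceLin X φ E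

theorem reduceLin_cons (p : ℕ × ℕ) (E : List (ℕ × ℕ)) (x : V) :
    reduceLin X φ (p :: E) x =
      reduceLin X φ E x - φ p.1 (reduceLin X φ E x) • X p.2 := rfl

theorem reduceLin_apply [CharP k 2] (hX : ∀ u v, X (u ^^^ v) = X u + X v) {a N : ℕ}
    (hR : ∀ u, Reads X φ (fun l => a ≤ l ∧ l < a + N) u) {E : List (ℕ × ℕ)}
    (hE : isEchelon a N E = true) (u : ℕ) :
    reduceLin X φ E (X u) = X (reduce E u) := by
  induction E with
  | nil => rfl
  | cons p E ih =>
    obtain ⟨hp, -, -, h3⟩ := isEchelon_cons.1 hE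
    rw [reduceLin_cons, ih h3, hR _ _ hp, reduce_cons]
    split_ifs
    · rw [hX, sub_eq_add_neg, ← neg_smul, CharTwo.neg_eq, one_smul]
    · rw [zero_smul, sub_zero]

theorem sub_reduceLin_mem (E : List (ℕ × ℕ)) (x : V) :
    x - reduceLin X φ E x ∈ spanList k X (E.map Prod.snd) := by
  induction E with
  | nil => simp [reduceLin]
  | cons p E ih =>
    rw [reduceLin_cons, List.map_cons, mem_spanList_cons]
    exact ⟨φ p.1 (reduceLin X φ E x), _, ih, by abel⟩

/-- Membership in the span becomes the vanishing of a linear map, so that "mapped into the span by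
an operator" is a kernel condition accessible to elimination. -/
theorem mem_spanList_iff_reduceLin [CharP k 2] (hX : ∀ u v, X (u ^^^ v) = X u + X v) {a N : ℕ}
    (hR : ∀ u, Reads X φ (fun l => a ≤ l ∧ l < a + N) u) {E : List (ℕ × ℕ)}
    (hE : isEchelon a N E = true) (x : V) :
    x ∈ spanList k X (E.map Prod.snd) ↔ reduceLin X φ E x = 0 := by
  constructor
  · intro hx
    have : spanList k X (E.map Prod.snd) ≤ LinearMap.ker (reduceLin X φ E) := by
      rw [spanList_le]
      intro u hu
      rw [LinearMap.mem_ker]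
      clear hx
      induction E with
      | nil => simp at hu
      | cons p E ih =>
        obtain ⟨hp, h1, h2, h3⟩ := isEchelon_cons.1 hE
        rw [reduceLin_cons]
        rw [List.map_cons, List.mem_cons] at hu
        rcases hu with rfl | hu
        -- The head has no bits at the pivots of the tail, so the projections of the tail fix it and
        -- the last one kills it.
        · rw [reduceLin_apply hX hR h3, reduce_eq_self h2, hR _ _ hp, h1, if_pos rfl, one_smul,
            sub_self]
        · rw [ih h3 hu, map_zero, zero_smul, sub_zero]
    exact this hx
  · intro hx
    have := sub_reduceLin_mem (X := X) (φ := φ) E x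
    rwa [hx, sub_zero] at this

end Span

end BitMask

/-! ### Bitmasks as vectors of a based space, and the flag argument -/

namespace BitMask

/-- The number of lowest bits of bitmasks which carry no information: numbers with many vanishing
lowest bits have colliding hash values, which slows down the evaluation by the kernel. -/
def shift : ℕ := 32

/-- The bitmask of the `j`-th basis vector. -/
def bit (j : ℕ) : ℕ := 2 ^ (j + shift) + (j + 1) * 2654435769 % 2 ^ 32

theorem bit_shiftRight (j : ℕ) : bit j >>> shift = 2 ^ j := by
  rw [bit, Nat.shiftRight_eq_div_pow, pow_add, shift, Nat.mul_comm,
    Nat.mul_add_div (by positivity), Nat.div_eq_of_lt (Nat.mod_lt _ (by positivity)), add_zero]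

theorem testBit_bit (j l : ℕ) : (bit j).testBit (shift + l) = decide (j = l) := by
  rw [← Nat.testBit_shiftRight, bit_shiftRight, Nat.testBit_two_pow]

section Basis

variable {k : Type*} [Field k] {V : Type*} [AddCommGroup V] [Module k V] {D : ℕ}
  (B : Module.Basis (Fin D) k V)

/-- The sum of those basis vectors whose bit is set in `m`; the lowest bits are ignored. -/
noncomputable def toVec (m : ℕ) : V :=
  ∑ i : Fin D, (if m.testBit (shift + i) then (1 : k) else 0) • B i

/-- The coordinate functionals of a basis. -/
noncomputable def coordAt (l : ℕ) : V →ₗ[k] k := if h : l < D then B.coord ⟨l, h⟩ else 0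

theorem coordAt_toVec {l : ℕ} (hl : l < D) (m : ℕ) :
    coordAt B l (toVec B m) = if m.testBit (shift + l) then 1 else 0 := by
  rw [coordAt, dif_pos hl, Module.Basis.coord_apply, toVec, B.repr_sum_self]

/-- The functionals reading off the bits of bitmasks. -/
noncomputable def coordBit (l : ℕ) : V →ₗ[k] k := coordAt B (l - shift)

theorem reads_toVec (m : ℕ) :
    Reads (toVec B) (coordBit B) (fun l => shift ≤ l ∧ l < shift + D) m := by
  intro l hl
  rw [coordBit, coordAt_toVec B (by omega), Nat.add_sub_cancel' hl.1]

theorem ext_coordAt {x y : V} (h : ∀ l < D, coordAt B l x = coordAt B l y) : x = y := by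
  refine B.repr.injective (Finsupp.ext fun i => ?_)
  have := h i i.2
  rwa [coordAt, dif_pos i.2] at this

theorem toVec_ext {u v : ℕ} (h : ∀ l < D, u.testBit (shift + l) = v.testBit (shift + l)) :
    toVec B u = toVec B v :=
  ext_coordAt B fun l hl => by rw [coordAt_toVec B hl, coordAt_toVec B hl, h l hl]

theorem toVec_xor [CharP k 2] (u v : ℕ) : toVec B (u ^^^ v) = toVec B u + toVec B v := by
  refine ext_coordAt B fun l hl => ?_
  rw [map_add, coordAt_toVec B hl, coordAt_toVec B hl, coordAt_toVec B hl, Nat.testBit_xor]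
  cases u.testBit (shift + l) <;> cases v.testBit (shift + l) <;> simp [CharTwo.add_self_eq_zero]

theorem toVec_zero : toVec B 0 = 0 := by simp [toVec]

theorem toVec_bit (i : Fin D) : toVec B (bit i.1) = B i := by
  rw [toVec, Finset.sum_eq_single i]
  · simp [testBit_bit]
  · intro j _ hj
    have : i.1 ≠ j.1 := fun h => hj (Fin.ext h.symm)
    simp [testBit_bit, this]
  · simp

theorem toVec_ne_zero {m l : ℕ} (hl : l < D) (h : m.testBit (shift + l) = true) :
    toVec B m ≠ 0 := by
  intro h0
  have := coordAt_toVec B hl m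
  rw [h0, map_zero, h, if_pos rfl] at this
  exact zero_ne_one this

/-- The bitmask with the given set bits (each counted modulo two). -/
def ofBits : List ℕ → ℕ
  | [] => 0
  | i :: l => bit i ^^^ ofBits l

/-- The sum of the basis vectors with the given indices. -/
noncomputable def sumVec (l : List ℕ) : V := toVec B (ofBits l)

theorem sumVec_cons [CharP k 2] (i : ℕ) (l : List ℕ) :
    sumVec B (i :: l) = toVec B (bit i) + sumVec B l := toVec_xor B _ _

/-- The flag of subspaces of a based vector space. -/
def flag (d : ℕ) : Submodule k V where
  carrier := {x | ∀ l < d, coordAt B l x = 0}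
  zero_mem' l _ := map_zero _
  add_mem' hx hy l hl := by rw [map_add, hx l hl, hy l hl, add_zero]
  smul_mem' c x hx l hl := by rw [map_smul, hx l hl, smul_zero]

theorem mem_flag_iff_span {d : ℕ} {x : V} (hx : x ∈ flag B d) :
    x ∈ spanList k (toVec B) (((List.range D).filter (d ≤ ·)).map bit) := by
  rw [← B.sum_repr x]
  refine Submodule.sum_mem _ fun i _ => ?_
  by_cases hd : d ≤ i.1
  · rw [← toVec_bit]
    exact Submodule.smul_mem _ _ (mem_spanList
      (List.mem_map.2 ⟨i.1, List.mem_filter.2 ⟨by simp, by simpa using hd⟩, rfl⟩))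
  · have := hx i.1 (by omega)
    rw [coordAt, dif_pos i.2] at this
    rw [← Module.Basis.coord_apply, this, zero_smul]
    exact Submodule.zero_mem _

end Basis

/-- A subspace not contained in `M` and stable under a family of operators shifting a finite
filtration contains a vector outside `M` mapped to `M` by the operators. -/
theorem exists_map_mem {k V : Type*} [Field k] [AddCommGroup V] [Module k V]
    (F : ℕ → Submodule k V) {D : ℕ} (hF0 : F 0 = ⊤) (hFD : F D = ⊥)
    (T : Set (V →ₗ[k] V)) (hT : ∀ t ∈ T, ∀ d < D, ∀ x ∈ F d, t x ∈ F (d + 1))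
    {M W : Submodule k V} (hW : ∀ t ∈ T, ∀ x ∈ W, t x ∈ W) (hWM : ¬ W ≤ M) :
    ∃ x ∈ W, x ∉ M ∧ ∀ t ∈ T, t x ∈ M := by
  classical
  have hex : ∃ d, ∀ x ∈ W, x ∈ F d → x ∈ M :=
    ⟨D, fun x _ hx => by
      rw [hFD] at hx
      rw [(Submodule.mem_bot k).1 hx]
      exact M.zero_mem⟩
  have hspec := Nat.find_spec hex
  have hle : Nat.find hex ≤ D := Nat.find_min' hex fun x _ hx => by
      rw [hFD] at hx
      rw [(Submodule.mem_bot k).1 hx]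
      exact M.zero_mem
  -- The least index at which `W ∩ F d` lies in `M` is positive because `F 0` is the whole space and
  -- `W` is not contained in `M`. One step before it a vector outside `M` survives, and the
  -- operators push it into the next step.
  obtain ⟨d, hd⟩ : ∃ d, Nat.find hex = d + 1 := by
    refine Nat.exists_eq_succ_of_ne_zero fun h0 => hWM fun x hx => hspec x hx ?_
    rw [h0, hF0]
    trivial
  have hmin := Nat.find_min hex (m := d) (by omega)
  push Not at hmin
  obtain ⟨x, hxW, hxF, hxM⟩ := hmin
  refine ⟨x, hxW, hxM, fun t ht => hspec _ (hW t ht x hxW) ?_⟩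
  rw [hd]
  exact hT t ht d (by omega) x hxF

/-! ### Brackets on bitmasks -/

section Bracket

/-- The bracket of a sum of basis vectors with a basis vector. -/
def lieBasis (br : ℕ → ℕ → ℕ) : List ℕ → ℕ → ℕ
  | [], _ => 0
  | i :: p, j => br i j ^^^ lieBasis br p j

/-- The bracket of two sums of basis vectors. -/
def lieSum (br : ℕ → ℕ → ℕ) (p : List ℕ) : List ℕ → ℕ
  | [] => 0
  | j :: q => lieBasis br p j ^^^ lieSum br p q

/-- The images of the `j`-th basis vector under the operators `x ↦ ⁅p, x⁆` modulo the span of an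
echelon form `E`, concatenated. -/
def images (br : ℕ → ℕ → ℕ) (D : ℕ) (E : List (ℕ × ℕ)) : List (List ℕ) → ℕ → ℕ
  | [], _ => 0
  | p :: ops, j =>
    (reduce E (lieBasis br p j) >>> shift % 2 ^ D) ||| (images br D E ops j <<< D)

/-- The `j`-th basis vector, preceded by its images. -/
def column (br : ℕ → ℕ → ℕ) (D : ℕ) (E : List (ℕ × ℕ)) (ops : List (List ℕ)) (j : ℕ) : ℕ :=
  bit j ||| images br D E ops j <<< (shift + D)

/-- The kernel of the first `r` of the operators `x ↦ ⁅p, x⁆` modulo the span of `E`, preceded by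
the images under all the operators. -/
def kernelColumns (br : ℕ → ℕ → ℕ) (D : ℕ) (E : List (ℕ × ℕ)) (ops : List (List ℕ)) (r : ℕ) :
    List ℕ :=
  eliminate (shift + D) (r * D) ((List.range D).map (column br D E ops))

variable {k : Type*} [Field k] {L : Type*} [LieRing L] [LieAlgebra k L] {D : ℕ}
  (B : Module.Basis (Fin D) k L)

/-- On the indices satisfying `adm`, the function `br` gives the brackets of basis vectors. -/
def IsBracket (adm : ℕ → Bool) (br : ℕ → ℕ → ℕ) : Prop :=
  ∀ i j, adm i = true → j < D → ⁅toVec B (bit i), toVec B (bit j)⁆ = toVec B (br i j)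

variable {B} {adm : ℕ → Bool} {br : ℕ → ℕ → ℕ}

theorem IsBracket.lieBasis [CharP k 2] (h : IsBracket B adm br) {p : List ℕ}
    (hp : ∀ i ∈ p, adm i = true) {j : ℕ} (hj : j < D) : ⁅sumVec B p, toVec B (bit j)⁆ = toVec B (lieBasis br p j) := by
  induction p with
  | nil => simp [sumVec, ofBits, BitMask.lieBasis, toVec_zero]
  | cons i p ih =>
    rw [sumVec_cons, add_lie, ih fun i hi => hp i (List.mem_cons_of_mem _ hi),
      h i j (hp i List.mem_cons_self) hj, BitMask.lieBasis, toVec_xor]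

theorem IsBracket.lieSum [CharP k 2] (h : IsBracket B adm br) {p q : List ℕ}
    (hp : ∀ i ∈ p, adm i = true)
    (hq : ∀ i ∈ q, i < D) : ⁅sumVec B p, sumVec B q⁆ = toVec B (lieSum br p q) := by
  induction q with
  | nil => simp [sumVec, ofBits, BitMask.lieSum, toVec_zero]
  | cons j q ih =>
    rw [sumVec_cons, lie_add, ih fun i hi => hq i (List.mem_cons_of_mem _ hi),
      h.lieBasis hp (hq j List.mem_cons_self), BitMask.lieSum, toVec_xor]

variable (B)

/-- The functionals reading off the bits of `images`. -/
noncomputable def columnFunctional (E : List (ℕ × ℕ)) : List (List ℕ) → ℕ → L →ₗ[k] k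
  | [], _ => 0
  | p :: ops, l => if l < D then
      coordAt B l ∘ₗ reduceLin (toVec B) (coordBit B) E ∘ₗ
        (LieAlgebra.ad k L (sumVec B p) : L →ₗ[k] L)
      else columnFunctional E ops (l - D)

variable {B}

/-- The functionals come in blocks of length `D`, one block of coordinates for each operator. -/
theorem columnFunctional_eq_zero_iff (E : List (ℕ × ℕ)) (ops : List (List ℕ)) (x : L) :
    (∀ l < ops.length * D, columnFunctional B E ops l x = 0) ↔
      ∀ p ∈ ops, reduceLin (toVec B) (coordBit B) E ⁅sumVec B p, x⁆ = 0 := by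
  induction ops with
  | nil => simp
  | cons p ops ih =>
    rw [List.forall_mem_cons, ← ih]
    constructor
    · intro h
      constructor
      · refine ext_coordAt B fun l hl => ?_
        have := h l (by rw [List.length_cons, add_mul]; omega)
        rw [columnFunctional, if_pos hl] at this
        rw [map_zero]
        exact this
      · intro l hl
        have := h (l + D) (by rw [List.length_cons, add_mul]; omega)
        rwa [columnFunctional, if_neg (by omega), Nat.add_sub_cancel] at this
    · rintro ⟨h1, h2⟩ l hl
      rw [List.length_cons, add_mul] at hl
      rw [columnFunctional]
      split_ifs with hD
      · change coordAt B l (reduceLin _ _ E ⁅sumVec B p, x⁆) = 0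
        rw [h1, map_zero]
      · exact h2 _ (by omega)

theorem columnFunctional_bit [CharP k 2] (h : IsBracket B adm br) {E : List (ℕ × ℕ)}
    (hE : isEchelon shift D E = true) {ops : List (List ℕ)}
    (hops : ∀ p ∈ ops, ∀ i ∈ p, adm i = true) {j : ℕ} (hj : j < D) (l : ℕ)
    (hl : l < ops.length * D) : columnFunctional B E ops l (toVec B (bit j)) =
      if (images br D E ops j).testBit l then 1 else 0 := by
  induction ops generalizing l with
  | nil => simp at hl
  | cons p ops ih =>
    rw [List.length_cons, add_mul] at hl
    rw [columnFunctional, images]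
    split_ifs with hD hb hb
    · change coordAt B l (reduceLin _ _ E ⁅sumVec B p, toVec B (bit j)⁆) = 1
      rw [h.lieBasis (hops p List.mem_cons_self) hj,
        reduceLin_apply (toVec_xor B) (reads_toVec B) hE, coordAt_toVec B hD]
      have h3 : ¬ D ≤ l := by omega
      simpa [Nat.testBit_or, hD, h3] using hb
    · change coordAt B l (reduceLin _ _ E ⁅sumVec B p, toVec B (bit j)⁆) = 0
      rw [h.lieBasis (hops p List.mem_cons_self) hj,
        reduceLin_apply (toVec_xor B) (reads_toVec B) hE, coordAt_toVec B hD]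
      have h3 : ¬ D ≤ l := by omega
      simpa [Nat.testBit_or, hD, h3] using hb
    all_goals
      rw [ih (fun p hp => hops p (List.mem_cons_of_mem _ hp)) (l - D) (by omega)]
      have h3 : D ≤ l := by omega
      simpa [Nat.testBit_or, hD, h3] using hb

/-- The images are stored from bit `shift + D` on, which `toVec` ignores. A column thus carries a
vector together with its images, and the elimination keeps track of both. -/
theorem toVec_column (E : List (ℕ × ℕ)) (ops : List (List ℕ)) (j : ℕ) :
    toVec B (column br D E ops j) = toVec B (bit j) := by
  refine toVec_ext B fun l hl => ?_
  have h1 : ¬ shift + D ≤ shift + l := by omega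
  rw [column, Nat.testBit_or, Nat.testBit_shiftLeft]
  simp only [h1, decide_false, Bool.false_and, Bool.or_false]

theorem testBit_column (E : List (ℕ × ℕ)) (ops : List (List ℕ)) {j : ℕ} (hj : j < D) {l : ℕ}
    (hl : shift + D ≤ l) :
    (column br D E ops j).testBit l = (images br D E ops j).testBit (l - (shift + D)) := by
  have h1 : (bit j).testBit l = false := by
    rw [show l = shift + (l - shift) by omega, testBit_bit, decide_eq_false_iff_not]
    omega
  rw [column, Nat.testBit_or, Nat.testBit_shiftLeft, h1]
  simp [hl]

theorem reads_column [CharP k 2] (h : IsBracket B adm br) {E : List (ℕ × ℕ)}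
    (hE : isEchelon shift D E = true) {ops : List (List ℕ)}
    (hops : ∀ p ∈ ops, ∀ i ∈ p, adm i = true) {j : ℕ} (hj : j < D) :
    Reads (toVec B) (fun l => columnFunctional B E ops (l - (shift + D)))
      (fun l => shift + D ≤ l ∧ l < shift + D + ops.length * D) (column br D E ops j) := by
  intro l hl
  rw [toVec_column, testBit_column E ops hj hl.1, columnFunctional_bit h hE hops hj _ (by omega)]

theorem spanList_column (E : List (ℕ × ℕ)) (ops : List (List ℕ)) :
    spanList k (toVec B) ((List.range D).map (column br D E ops)) = ⊤ := by
  rw [eq_top_iff, ← B.span_eq, Submodule.span_le]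
  rintro _ ⟨i, rfl⟩
  have := mem_spanList (k := k) (X := toVec B)
    (l := (List.range D).map (column br D E ops)) (u := column br D E ops i.1)
    (List.mem_map.2 ⟨i.1, by simp, rfl⟩)
  rwa [toVec_column, toVec_bit] at this

theorem columnFunctional_append (E : List (ℕ × ℕ)) (ops ops' : List (List ℕ)) {l : ℕ}
    (hl : l < ops.length * D) :
    columnFunctional B E (ops ++ ops') l = columnFunctional B E ops l := by
  induction ops generalizing l with
  | nil => simp at hl
  | cons p ops ih =>
    rw [List.length_cons, add_mul] at hl
    rw [List.cons_append, columnFunctional, columnFunctional]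
    split_ifs with hD
    · rfl
    · exact ih (by omega)

/-- The first `r` operators determine the span of the kernel found by elimination. -/
theorem mem_span_kernelColumns [CharP k 2] (h : IsBracket B adm br) {E : List (ℕ × ℕ)}
    (hE : isEchelon shift D E = true) {ops ops' : List (List ℕ)}
    (hops : ∀ p ∈ ops ++ ops', ∀ i ∈ p, adm i = true) {x : L}
    (hx : ∀ p ∈ ops, ⁅sumVec B p, x⁆ ∈ spanList k (toVec B) (E.map Prod.snd)) :
    x ∈ spanList k (toVec B) (kernelColumns br D E (ops ++ ops') ops.length) := by
  refine mem_spanList_eliminate (toVec_xor B)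
    (φ := fun l => columnFunctional B E (ops ++ ops') (l - (shift + D))) (fun u hu => ?_) ?_ ?_
  · obtain ⟨j, hj, rfl⟩ := List.mem_map.1 hu
    intro l hl
    refine reads_column h hE hops (List.mem_range.1 hj) l ?_
    rw [List.length_append, add_mul]
    omega
  · rw [spanList_column]
    trivial
  · intro l hl
    rw [columnFunctional_append E ops ops' (by omega)]
    refine (columnFunctional_eq_zero_iff E ops x).2 (fun p hp => ?_) _ (by omega)
    exact (mem_spanList_iff_reduceLin (toVec_xor B) (reads_toVec B) hE _).1 (hx p hp)

/-- The elimination uses the first `r` operators only, but the columns record the images under all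
of them. If nothing is left above bit `shift + D`, the vector is also mapped into the span by the
operators that were not imposed. -/
theorem lie_mem_of_mem_kernelColumns [CharP k 2] (h : IsBracket B adm br) {E : List (ℕ × ℕ)}
    (hE : isEchelon shift D E = true) {ops : List (List ℕ)}
    (hops : ∀ p ∈ ops, ∀ i ∈ p, adm i = true) {r u : ℕ}
    (hu : u ∈ kernelColumns br D E ops r) (h0 : u >>> (shift + D) = 0) {p : List ℕ}
    (hp : p ∈ ops) :
    ⁅sumVec B p, toVec B u⁆ ∈ spanList k (toVec B) (E.map Prod.snd) := by
  rw [mem_spanList_iff_reduceLin (toVec_xor B) (reads_toVec B) hE]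
  refine (columnFunctional_eq_zero_iff E ops _).1 (fun l hl => ?_) p hp
  have := reads_of_mem_eliminate (X := toVec B)
    (φ := fun l => columnFunctional B E ops (l - (shift + D)))
    (S := fun l => shift + D ≤ l ∧ l < shift + D + ops.length * D) (toVec_xor B)
    (fun u hu => ?_) u hu (shift + D + l) ⟨by omega, by omega⟩
  · dsimp only at this
    rw [Nat.add_sub_cancel_left, ← Nat.testBit_shiftRight, h0, Nat.zero_testBit] at this
    rw [this, if_neg (by simp)]
  · obtain ⟨j, hj, rfl⟩ := List.mem_map.1 hu
    exact reads_column h hE hops (List.mem_range.1 hj)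

theorem flag_zero : flag B 0 = ⊤ := by
  rw [eq_top_iff]
  intro x _ l hl
  omega

theorem flag_self : flag B D = ⊥ := by
  rw [eq_bot_iff]
  intro x hx
  rw [Submodule.mem_bot]
  exact ext_coordAt B fun l hl => by rw [hx l hl, map_zero]

/-- The operator `x ↦ ⁅p, x⁆` raises the indices of basis vectors. -/
def isRaising (br : ℕ → ℕ → ℕ) (D : ℕ) (p : List ℕ) : Bool :=
  (List.range D).all fun j => lieBasis br p j >>> shift % 2 ^ (j + 1) == 0

theorem lie_mem_flag [CharP k 2] (h : IsBracket B adm br) {p : List ℕ} (hp : ∀ i ∈ p, adm i = true)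
    (hr : isRaising br D p = true) {d : ℕ} {x : L} (hx : x ∈ flag B d) :
    ⁅sumVec B p, x⁆ ∈ flag B (d + 1) := by
  have h1 := mem_flag_iff_span B hx
  have : spanList k (toVec B) (((List.range D).filter (d ≤ ·)).map bit) ≤
      (flag B (d + 1)).comap (LieAlgebra.ad k L (sumVec B p) : L →ₗ[k] L) := by
    rw [spanList_le]
    intro u hu
    obtain ⟨j, hj, rfl⟩ := List.mem_map.1 hu
    obtain ⟨hjD, hdj⟩ := List.mem_filter.1 hj
    rw [List.mem_range] at hjD
    have hdj : d ≤ j := by simpa using hdj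
    change ⁅sumVec B p, toVec B (bit j)⁆ ∈ flag B (d + 1)
    rw [h.lieBasis hp hjD]
    intro l hl
    by_cases hlD : l < D
    · rw [coordAt_toVec B hlD, if_neg]
      rw [isRaising, List.all_eq_true] at hr
      have h2 := hr j (List.mem_range.2 hjD)
      have h3 := Nat.testBit_mod_two_pow (lieBasis br p j >>> shift) (j + 1) l
      rw [beq_iff_eq] at h2
      rw [h2, Nat.zero_testBit, Nat.testBit_shiftRight] at h3
      have h4 : l < j + 1 := by omega
      simpa [h4] using h3.symm
    · rw [coordAt, dif_neg hlD, LinearMap.zero_apply]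
  exact this h1

/-- The Engel-type step for raising elements of the Lie algebra. It is used with `M` the presumed
radical and with `M` the presumed maximal subalgebra. -/
theorem exists_lie_mem [CharP k 2] (h : IsBracket B adm br) {ops : List (List ℕ)}
    (hops : ∀ p ∈ ops, ∀ i ∈ p, adm i = true) (hr : ∀ p ∈ ops, isRaising br D p = true)
    {M W : Submodule k L} (hW : ∀ p ∈ ops, ∀ x ∈ W, ⁅sumVec B p, x⁆ ∈ W) (hWM : ¬ W ≤ M) :
    ∃ x ∈ W, x ∉ M ∧ ∀ p ∈ ops, ⁅sumVec B p, x⁆ ∈ M := by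
  obtain ⟨x, hx, hxM, hT⟩ := exists_map_mem (flag B) flag_zero flag_self
    {t | ∃ p ∈ ops, t = (LieAlgebra.ad k L (sumVec B p) : L →ₗ[k] L)} (M := M) (W := W)
    (by
      rintro _ ⟨p, hp, rfl⟩ d _ x hx
      exact lie_mem_flag h (hops p hp) (hr p hp) hx)
    (by
      rintro _ ⟨p, hp, rfl⟩ x hx
      exact hW p hp x hx) hWM
  exact ⟨x, hx, hxM, fun p hp => hT _ ⟨p, hp, rfl⟩⟩

end Bracket

end BitMask

/-! ## Certificates for the normaliser of the radical of a normaliser -/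

namespace BitMask

/-- Pairs the bitmasks with their leading bits. -/
def withPivots (ms : List ℕ) : List (ℕ × ℕ) := ms.map fun m => (m.log2, m)

theorem withPivots_map_snd (ms : List ℕ) : (withPivots ms).map Prod.snd = ms := by
  simp [withPivots, Function.comp_def]

/-- Checks a sequence of triples `(p, r, t)` with `⁅p, r⁆ = t`, where `p` and `r` are known or
acceptable, and that all elements of `final` are finally known. -/
def checkWords (adm : ℕ → Bool) (br : ℕ → ℕ → ℕ) (D : ℕ) (okL okR : List ℕ → Bool) :
    List (List ℕ) → List (List ℕ × List ℕ × List ℕ) → List (List ℕ) → Bool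
  | known, [], final => final.all fun t => known.contains t || okR t
  | known, (p, r, t) :: ws, final =>
    p.all adm && r.all (· < D) && (known.contains p || okL p) && (known.contains r || okR r) &&
      ofBits t == lieSum br p r && checkWords adm br D okL okR (t :: known) ws final

section

variable {k : Type*} [Field k] {L : Type*} [LieRing L] [LieAlgebra k L] {D : ℕ}
  {B : Module.Basis (Fin D) k L} {adm : ℕ → Bool} {br : ℕ → ℕ → ℕ}

/-- The hypothesis `hL` only asks that acceptable left factors preserve `W`. For the radical these
are elements of `𝔫_e`, which need not lie in `W`. -/
theorem mem_of_checkWords [CharP k 2] (h : IsBracket B adm br) {okL okR : List ℕ → Bool}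
    {W : Submodule k L} (hL : ∀ p, p.all adm = true → okL p = true →
      ∀ x ∈ W, ⁅sumVec B p, x⁆ ∈ W)
    (hW : ∀ x ∈ W, ∀ y ∈ W, ⁅x, y⁆ ∈ W) (hR : ∀ r, okR r = true → sumVec B r ∈ W)
    {known final : List (List ℕ)} {ws : List (List ℕ × List ℕ × List ℕ)}
    (hk : ∀ r ∈ known, sumVec B r ∈ W)
    (hc : checkWords adm br D okL okR known ws final = true) : ∀ t ∈ final, sumVec B t ∈ W := by
  induction ws generalizing known with
  | nil =>
    intro t ht
    rw [checkWords, List.all_eq_true] at hc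
    have h0 := hc t ht
    rw [Bool.or_eq_true] at h0
    rcases h0 with h1 | h1
    · exact hk t (by simpa using h1)
    · exact hR t h1
  | cons w ws ih =>
    obtain ⟨p, r, t⟩ := w
    simp only [checkWords, Bool.and_eq_true, Bool.or_eq_true, beq_iff_eq] at hc
    obtain ⟨⟨⟨⟨⟨h1, h2⟩, h3⟩, h4⟩, h5⟩, h6⟩ := hc
    refine ih (known := t :: known) (fun s hs => ?_) h6
    rcases List.mem_cons.1 hs with rfl | hs
    · have hr : sumVec B r ∈ W := by
        rcases h4 with h4 | h4
        · exact hk r (by simpa using h4)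
        · exact hR r h4
      rw [sumVec, h5, ← h.lieSum (by simpa using h1) (by simpa using h2)]
      rcases h3 with h3 | h3
      · exact hW _ (hk p (by simpa using h3)) _ hr
      · exact hL p h1 h3 _ hr
    · exact hk s hs

/-- A set whose elements are brackets of its own elements stays inside every term of the derived
series, the last of which is zero. -/
theorem eq_zero_of_mem_solvable {L : Type*} [LieRing L] [LieAlgebra k L] (R : LieIdeal k L)
    [LieAlgebra.IsSolvable R] {J : Set L} (hJ : ∀ x ∈ J, x ∈ R)
    (hp : ∀ x ∈ J, ∃ y ∈ J, ∃ z ∈ J, x = ⁅y, z⁆) : ∀ x ∈ J, x = 0 := by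
  obtain ⟨n, hn⟩ := LieAlgebra.IsSolvable.solvable k R
  rw [LieIdeal.derivedSeries_eq_bot_iff] at hn
  have key : ∀ i, ∀ x ∈ J, x ∈ LieAlgebra.derivedSeriesOfIdeal k L i R := by
    intro i
    induction i with
    | zero => exact hJ
    | succ i ih =>
      intro x hx
      obtain ⟨y, hy, z, hz, rfl⟩ := hp x hx
      rw [LieAlgebra.derivedSeriesOfIdeal_succ]
      exact LieSubmodule.lie_mem_lie (ih y hy) (ih z hz)
  intro x hx
  have := key n x hx
  rwa [hn, LieSubmodule.mem_bot] at this

end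

/-- The data certifying the structure of `normalizerOfRadical`:
* the radical of the normaliser of the element `e` is spanned by `e`, the sums of basis vectors in
  `rad` and the central elements `center`;
* `dim` is the dimension of the normaliser of the radical;
* up to the radical, the only element of the normaliser of `e` which is mapped to the radical by all
  operators in `radOps` is `radTop`, and the ideal it generates contains the elements
  occurring in `perfect`, which are brackets of such elements;
* up to elements of the normaliser of the radical, the only element mapped into it by all operators
  in `maxOps` is `maxTop`, which generates the algebra together with this normaliser. -/
structure Certificate where
  e : List ℕ
  rad : List (List ℕ)
  center : List (List ℕ)
  dim : ℕ
  radOps : List (List ℕ)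
  radTop : List ℕ
  radWords : List (List ℕ × List ℕ × List ℕ)
  perfect : List (List ℕ × List ℕ × List ℕ)
  maxOps : List (List ℕ)
  maxTop : List ℕ
  maxWords : List (List ℕ × List ℕ × List ℕ)
  gens : List (List ℕ)

namespace Certificate

variable (c : Certificate) (adm : ℕ → Bool) (br : ℕ → ℕ → ℕ) (D : ℕ)

/-- The echelon form of the radical. -/
def radical : List (ℕ × ℕ) := withPivots ((c.e :: c.rad ++ c.center).map ofBits)

/-- The basis of the normaliser of the radical. -/
def normalizer : List ℕ := kernelColumns br D c.radical (c.e :: c.rad) 1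

/-- The operator normalises `e`. -/
def normalizes (p : List ℕ) : Bool :=
  lieSum br p c.e == 0 || lieSum br p c.e == ofBits c.e

/-- The operator normalises the radical. -/
def normalizesRadical (p : List ℕ) : Bool :=
  p.all adm && (c.e :: c.rad).all fun a => reduce c.radical (lieSum br p a) == 0

/-- The check of the structure of the radical and its normaliser. -/
def checkNormalizer : Bool :=
  isEchelon shift D c.radical && (c.e :: c.rad).all (fun a => a.all adm) &&
  (c.e :: c.rad).all (fun a => (c.e :: c.rad).all fun b => lieSum br a b == 0) &&
  forceList (c.normalizer br D) fun ms =>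
    ms.all (fun m => m >>> (shift + D) == 0) &&
      isEchelon shift D (withPivots ms) && ms.length == c.dim && decide (c.dim < D)

/-- The check that the normaliser of `e` has no larger solvable ideal. -/
def checkRadical : Bool :=
  c.radOps.all (fun p => p.all adm && isRaising br D p && c.normalizes br p) &&
  (kernelColumns br D c.radical (c.e :: c.radOps) (c.radOps.length + 1)).all (fun u =>
    force (reduce c.radical u) fun r =>
      r == 0 || r == ofBits c.radTop) &&
  checkWords adm br D (c.normalizes br) (fun _ => false) [c.radTop] c.radWords
    (c.perfect.map fun t => t.2.2) &&
  c.perfect.all (fun t => t.1.all adm && t.2.1.all (· < D) &&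
    (c.perfect.map fun t => t.2.2).contains t.1 &&
    (c.perfect.map fun t => t.2.2).contains t.2.1 &&
    ofBits t.2.2 == lieSum br t.1 t.2.1) &&
  c.perfect.any (fun t => (List.range D).any fun i => (ofBits t.2.2).testBit (shift + i))

/-- The check that the normaliser of the radical is maximal. -/
def checkMaximal : Bool :=
  c.maxOps.all (fun p => isRaising br D p && c.normalizesRadical adm br p) &&
  forceList (c.normalizer br D) (fun ms => forceList (ms.map Nat.log2) fun ls =>
    (kernelColumns br D (ls.zip ms) c.maxOps c.maxOps.length).all (fun u =>
      force (reduce (ls.zip ms) u) fun r =>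
        r == 0 || r == ofBits c.maxTop)) &&
  checkWords adm br D (c.normalizesRadical adm br) (c.normalizesRadical adm br) [c.maxTop]
    c.maxWords c.gens

end Certificate

section

variable {k : Type*} [Field k] {L : Type*} [LieRing L] [LieAlgebra k L] {D : ℕ}
  {B : Module.Basis (Fin D) k L} {adm : ℕ → Bool} {br : ℕ → ℕ → ℕ} {c : Certificate}

/-- The radical described by a certificate. -/
noncomputable def Certificate.radicalSpan (c : Certificate) (B : Module.Basis (Fin D) k L) :
    Submodule k L :=
  spanList k (toVec B) ((c.e :: c.rad ++ c.center).map ofBits)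

/-- The normaliser described by a certificate. -/
noncomputable def Certificate.normalizerSpan (c : Certificate) (br : ℕ → ℕ → ℕ)
    (B : Module.Basis (Fin D) k L) : Submodule k L :=
  spanList k (toVec B) (c.normalizer br D)

theorem Certificate.radical_map_snd :
    c.radical.map Prod.snd = (c.e :: c.rad ++ c.center).map ofBits :=
  withPivots_map_snd _

/-- This is how a computed kernel is seen to be at most one-dimensional modulo the span of `E`. -/
theorem mem_sup_of_reduce [CharP k 2] {E : List (ℕ × ℕ)} {ms : List ℕ} {v : List ℕ}
    (h : ∀ m ∈ ms, reduce E m = 0 ∨ reduce E m = ofBits v) :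
    spanList k (toVec B) ms ≤
      Submodule.span k {sumVec B v} ⊔ spanList k (toVec B) (E.map Prod.snd) := by
  rw [spanList_le]
  intro m hm
  obtain ⟨y, hy, hm'⟩ := exists_reduce (k := k) (toVec_xor B) E m
  rw [hm']
  rcases h m hm with h0 | h0
  · rw [h0, toVec_zero, zero_add]
    exact Submodule.mem_sup_right hy
  · rw [h0]
    exact Submodule.add_mem_sup (Submodule.mem_span_singleton_self _) hy

theorem mem_of_mem_span_sup {W A : Submodule k L} (hA : A ≤ W) {v x : L}
    (hx : x ∈ Submodule.span k {v} ⊔ A) (hxW : x ∈ W) (hxA : x ∉ A) : v ∈ W := by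
  obtain ⟨y, hy, a, ha, rfl⟩ := Submodule.mem_sup.1 hx
  obtain ⟨d, rfl⟩ := Submodule.mem_span_singleton.1 hy
  have hd : d ≠ 0 := by
    rintro rfl
    rw [zero_smul, zero_add] at hxA
    exact hxA ha
  have h1 : d • v ∈ W := by
    have := W.sub_mem hxW (hA ha)
    rwa [add_sub_cancel_right] at this
  exact (Submodule.smul_mem_iff W hd).1 h1

variable (hbr : IsBracket B adm br) (hadm : ∀ i, adm i = true → i < D)
  (hZ : ∀ t ∈ c.center, ∀ x : L, ⁅sumVec B t, x⁆ = 0)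

theorem Certificate.sumVec_mem {a : List ℕ} (ha : a ∈ c.e :: c.rad) :
    sumVec B a ∈ c.radicalSpan B :=
  mem_spanList (List.mem_map.2 ⟨a, List.mem_append_left _ ha, rfl⟩)

-- The central elements are sums of Cartan elements, whereas `br` is only known to give brackets
-- whose left factor is built from admissible indices. They are therefore handled by `hZ`, and only
-- `e` and `rad` have to be checked.
include hZ in
theorem Certificate.lie_radical_induction {P : Submodule k L} {x : L}
    (h : ∀ a ∈ c.e :: c.rad, ⁅sumVec B a, x⁆ ∈ P) : ∀ a ∈ c.radicalSpan B, ⁅a, x⁆ ∈ P := by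
  have : c.radicalSpan B ≤ P.comap (LieAlgebra.ad k L x : L →ₗ[k] L) := by
    rw [Certificate.radicalSpan, spanList_le]
    intro m hm
    obtain ⟨a, ha, rfl⟩ := List.mem_map.1 hm
    change ⁅x, sumVec B a⁆ ∈ P
    rw [← lie_skew, P.neg_mem_iff]
    rcases List.mem_append.1 ha with ha | ha
    · exact h a ha
    · rw [hZ a ha]
      exact P.zero_mem
  intro a ha
  rw [← lie_skew, P.neg_mem_iff]
  exact this ha

include hbr hadm hZ in
theorem Certificate.lie_radical_radical [CharP k 2] (hc : c.checkNormalizer adm br D = true) :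
    ∀ x ∈ c.radicalSpan B, ∀ y ∈ c.radicalSpan B, ⁅x, y⁆ = 0 := by
  simp only [Certificate.checkNormalizer, Bool.and_eq_true, List.all_eq_true, beq_iff_eq] at hc
  obtain ⟨⟨⟨-, h2⟩, h3⟩, -⟩ := hc
  intro x hx y hy
  -- The induction reaches the left argument only, so it is applied twice, with the bracket reversed
  -- in between.
  have key : ∀ a ∈ c.e :: c.rad, ∀ b ∈ c.radicalSpan B, ⁅b, sumVec B a⁆ = 0 := by
    intro a ha b hb
    have := Certificate.lie_radical_induction hZ (P := ⊥) (x := sumVec B a) (fun b hb => by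
      rw [hbr.lieSum (h2 b hb) (fun i hi => hadm i (h2 a ha i hi)), h3 b hb a ha, toVec_zero]
      exact Submodule.zero_mem _) b hb
    exact (Submodule.mem_bot k).1 this
  have := Certificate.lie_radical_induction hZ (P := ⊥) (x := y) (fun a ha => by
    rw [← lie_skew, key a ha y hy, neg_zero]
    exact Submodule.zero_mem _) x hx
  exact (Submodule.mem_bot k).1 this

-- Only the bracket with `e` is imposed. That the resulting space normalises all of the radical is
-- the content of `Certificate.lie_mem_radical`.
include hbr in
theorem Certificate.mem_normalizer [CharP k 2] (hc : c.checkNormalizer adm br D = true) {x : L}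
    (hx : ⁅sumVec B c.e, x⁆ ∈ c.radicalSpan B) : x ∈ c.normalizerSpan br B := by
  simp only [Certificate.checkNormalizer, Bool.and_eq_true, List.all_eq_true] at hc
  obtain ⟨⟨⟨h1, h2⟩, -⟩, -⟩ := hc
  refine mem_span_kernelColumns (ops := [c.e]) (ops' := c.rad) hbr h1 h2 fun p hp => ?_
  rw [List.mem_singleton.1 hp, Certificate.radical_map_snd]
  exact hx

include hbr hZ in
theorem Certificate.lie_mem_radical [CharP k 2] (hc : c.checkNormalizer adm br D = true) {x : L}
    (hx : x ∈ c.normalizerSpan br B) : ∀ a ∈ c.radicalSpan B, ⁅a, x⁆ ∈ c.radicalSpan B := by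
  simp only [Certificate.checkNormalizer, Bool.and_eq_true, List.all_eq_true, forceList_eq,
    beq_iff_eq] at hc
  obtain ⟨⟨⟨h1, h2⟩, -⟩, ⟨⟨h4, -⟩, -⟩, -⟩ := hc
  refine Certificate.lie_radical_induction hZ fun a ha => ?_
  have : c.normalizerSpan br B ≤
      (c.radicalSpan B).comap (LieAlgebra.ad k L (sumVec B a) : L →ₗ[k] L) := by
    rw [Certificate.normalizerSpan, spanList_le]
    intro m hm
    have := lie_mem_of_mem_kernelColumns hbr h1 h2 hm (h4 m hm) ha
    rwa [Certificate.radical_map_snd] at this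
  exact this hx

-- One inclusion holds because the certified span is an abelian ideal of `𝔫_e`. For the other, a
-- larger radical would contain `radTop` and hence the hexagon of the certificate, contradicting
-- solvability.
include hbr hadm hZ in
theorem Certificate.radicalOfNormalizer_eq [CharP k 2] (hc : c.checkNormalizer adm br D = true)
    (hr : c.checkRadical adm br D = true) :
    (radicalOfNormalizer (k := k) (sumVec B c.e)).toSubmodule = c.radicalSpan B := by
  have hfin : Module.Finite k L := Module.Finite.of_basis B
  have habel := Certificate.lie_radical_radical hbr hadm hZ hc
  have hmemN : ∀ x ∈ elementNormalizer (k := k) (sumVec B c.e), x ∈ c.normalizerSpan br B := by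
    rintro x ⟨d, hd⟩
    refine Certificate.mem_normalizer hbr hc ?_
    rw [← lie_skew, hd]
    exact Submodule.neg_mem _
      (Submodule.smul_mem _ _ (Certificate.sumVec_mem List.mem_cons_self))
  have hmem : ∀ x, x ∈ (radicalOfNormalizer (k := k) (sumVec B c.e)).toSubmodule ↔
      ∃ y ∈ LieAlgebra.radical k (elementNormalizer (k := k) (sumVec B c.e)), (y : L) = x :=
    fun x => Iff.rfl
  have hle : c.radicalSpan B ≤ (radicalOfNormalizer (k := k) (sumVec B c.e)).toSubmodule := by
    let I : LieIdeal k (elementNormalizer (k := k) (sumVec B c.e)) :=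
      { (c.radicalSpan B).comap (elementNormalizer (k := k) (sumVec B c.e)).toSubmodule.subtype with
        lie_mem := by
          intro x m hm
          change ⁅(x : L), (m : L)⁆ ∈ c.radicalSpan B
          rw [← lie_skew]
          exact Submodule.neg_mem _
            (Certificate.lie_mem_radical hbr hZ hc (hmemN x x.2) m hm) }
    have hI : ∀ y, y ∈ I ↔ (y : L) ∈ c.radicalSpan B := fun y => Iff.rfl
    have hab : IsLieAbelian I := ⟨fun y z => by
      apply Subtype.ext
      apply Subtype.ext
      exact habel y.1.1 ((hI _).1 y.2) z.1.1 ((hI _).1 z.2)⟩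
    have hIR : I ≤ LieAlgebra.radical k (elementNormalizer (k := k) (sumVec B c.e)) :=
      (LieAlgebra.LieIdeal.solvable_iff_le_radical k _ I).1 inferInstance
    intro x hx
    exact (hmem x).2 ⟨⟨x, 0, by
      rw [habel x hx _ (Certificate.sumVec_mem List.mem_cons_self), zero_smul]⟩, hIR hx, rfl⟩
  refine le_antisymm ?_ hle
  by_contra hnot
  have hc' := hc
  simp only [Certificate.checkNormalizer, Bool.and_eq_true, List.all_eq_true] at hc'
  obtain ⟨⟨⟨hE, hadmA⟩, -⟩, -⟩ := hc'
  simp only [Certificate.checkRadical, Bool.and_eq_true, List.all_eq_true, force_eq] at hr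
  obtain ⟨⟨⟨⟨h1, h2⟩, h3⟩, h4⟩, h5⟩ := hr
  have hadme : ∀ i ∈ c.e, adm i = true := hadmA c.e List.mem_cons_self
  have hnorm : ∀ p : List ℕ, (∀ i ∈ p, adm i = true) → c.normalizes br p = true →
      sumVec B p ∈ elementNormalizer (k := k) (sumVec B c.e) := by
    intro p hp hn
    have hl := hbr.lieSum hp fun i hi => hadm i (hadme i hi)
    simp only [Certificate.normalizes, Bool.or_eq_true, beq_iff_eq] at hn
    rcases hn with hn | hn
    · exact ⟨0, by rw [hl, hn, toVec_zero, zero_smul]⟩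
    · exact ⟨1, by rw [hl, hn, one_smul]; rfl⟩
  have hlie : ∀ p : List ℕ, (∀ i ∈ p, adm i = true) → c.normalizes br p = true →
      ∀ x ∈ (radicalOfNormalizer (k := k) (sumVec B c.e)).toSubmodule,
      ⁅sumVec B p, x⁆ ∈ (radicalOfNormalizer (k := k) (sumVec B c.e)).toSubmodule := by
    intro p hp hn x hx
    obtain ⟨y, hy, rfl⟩ := (hmem x).1 hx
    exact (hmem _).2 ⟨⁅⟨sumVec B p, hnorm p hp hn⟩, y⁆, LieSubmodule.lie_mem _ hy, rfl⟩
  -- A putative element of the radical outside the certified span, chosen so deep in the flag that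
  -- all operators in `radOps` map it into that span.
  obtain ⟨x, hxR, hxA, hops⟩ := exists_lie_mem hbr (ops := c.radOps)
    (fun p hp => (h1 p hp).1.1) (fun p hp => (h1 p hp).1.2)
    (fun p hp x hx => hlie p (h1 p hp).1.1 (h1 p hp).2 x hx) hnot
  have hxe : ⁅sumVec B c.e, x⁆ ∈ c.radicalSpan B := by
    obtain ⟨y, -, rfl⟩ := (hmem x).1 hxR
    exact Certificate.lie_mem_radical hbr hZ hc (hmemN y y.2) _
      (Certificate.sumVec_mem List.mem_cons_self)
  -- The operator of `e` is imposed too: it confines the kernel to the normaliser of the certified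
  -- span, where `x` lies.
  have hxK := mem_span_kernelColumns hbr hE (ops := c.e :: c.radOps) (ops' := []) (x := x)
    (by
      intro p hp
      rw [List.append_nil] at hp
      rcases List.mem_cons.1 hp with rfl | hp
      · exact hadme
      · exact (h1 p hp).1.1)
    (by
      intro p hp
      rw [Certificate.radical_map_snd]
      rcases List.mem_cons.1 hp with rfl | hp
      · exact hxe
      · exact hops p hp)
  rw [List.append_nil] at hxK
  have hxs := mem_sup_of_reduce (E := c.radical) (v := c.radTop) (fun m hm => by
    simpa using h2 m hm) hxK
  rw [Certificate.radical_map_snd] at hxs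
  have htop := mem_of_mem_span_sup hle hxs hxR hxA
  have hwords := mem_of_checkWords hbr (W := (radicalOfNormalizer (k := k)
      (sumVec B c.e)).toSubmodule)
    (fun p hp hn => hlie p (by simpa using hp) hn)
    (fun x hx y hy => (radicalOfNormalizer (k := k) (sumVec B c.e)).lie_mem hx hy)
    (by simp) (by simpa using htop) h3
  -- The hexagon, viewed inside `𝔫_e`, lies in the radical and consists of brackets of its own
  -- elements.
  have hJ := eq_zero_of_mem_solvable
    (LieAlgebra.radical k (elementNormalizer (k := k) (sumVec B c.e)))
    (J := {y | ∃ t ∈ c.perfect.map (fun t => t.2.2), (y : L) = sumVec B t})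
    (by
      rintro y ⟨t, ht, hy⟩
      obtain ⟨z, hz, hzy⟩ := (hmem _).1 (hwords t ht)
      rwa [Subtype.ext (hy.trans hzy.symm)])
    (by
      rintro y ⟨t, ht, hy⟩
      obtain ⟨⟨a, b, d⟩, ht', rfl⟩ := List.mem_map.1 ht
      have h6 := h4 _ ht'
      simp only [List.contains_iff_mem, beq_iff_eq,
        decide_eq_true_eq] at h6
      obtain ⟨⟨⟨⟨ha, hb⟩, ha'⟩, hb'⟩, hab⟩ := h6
      obtain ⟨a', -, haa⟩ := (hmem _).1 (hwords a ha')
      obtain ⟨b', -, hbb⟩ := (hmem _).1 (hwords b hb')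
      refine ⟨a', ⟨a, ha', haa⟩, b', ⟨b, hb', hbb⟩, Subtype.ext ?_⟩
      rw [hy, LieSubalgebra.coe_bracket, haa, hbb, hbr.lieSum ha hb, ← hab]
      rfl)
  simp only [List.any_eq_true, List.mem_range] at h5
  obtain ⟨t, ht, i, hi, hbit⟩ := h5
  have htm : t.2.2 ∈ c.perfect.map (fun t => t.2.2) := List.mem_map.2 ⟨t, ht, rfl⟩
  obtain ⟨y, -, hy⟩ := (hmem _).1 (hwords _ htm)
  have h0 := hJ y ⟨_, htm, hy⟩
  rw [h0] at hy
  exact toVec_ne_zero B hi hbit hy.symm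

include hbr hadm hZ in
theorem Certificate.normalizerOfRadical_eq [CharP k 2] (hc : c.checkNormalizer adm br D = true)
    (hr : c.checkRadical adm br D = true) :
    (normalizerOfRadical (k := k) (sumVec B c.e)).toSubmodule = c.normalizerSpan br B := by
  have hrad := Certificate.radicalOfNormalizer_eq hbr hadm hZ hc hr
  ext x
  change x ∈ (radicalOfNormalizer (k := k) (sumVec B c.e)).normalizer ↔ _
  rw [LieSubalgebra.mem_normalizer_iff]
  have hmem : ∀ y, y ∈ radicalOfNormalizer (k := k) (sumVec B c.e) ↔ y ∈ c.radicalSpan B := by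
    intro y
    rw [← hrad]
    rfl
  simp only [hmem]
  constructor
  · intro h
    refine Certificate.mem_normalizer hbr hc ?_
    rw [← lie_skew]
    exact Submodule.neg_mem _ (h _ (Certificate.sumVec_mem List.mem_cons_self))
  · intro h a ha
    rw [← lie_skew]
    exact Submodule.neg_mem _ (Certificate.lie_mem_radical hbr hZ hc h a ha)

-- A strictly larger subalgebra `N` contains an element outside the normaliser that the operators in
-- `maxOps` map into it. Since the kernel is at most one-dimensional modulo the normaliser, `maxTop`
-- lies in `N`, and the recorded words lead from it to generators.
include hbr hadm hZ in
theorem Certificate.isCoatom_normalizerOfRadical [CharP k 2]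
    (hc : c.checkNormalizer adm br D = true)
    (hr : c.checkRadical adm br D = true) (hm : c.checkMaximal adm br D = true)
    (hgen : ∀ N : LieSubalgebra k L, (∀ t ∈ c.gens, sumVec B t ∈ N) → N = ⊤) :
    Module.finrank k (normalizerOfRadical (k := k) (sumVec B c.e)) = c.dim ∧
      IsCoatom (normalizerOfRadical (k := k) (sumVec B c.e)) := by
  have hfin : Module.Finite k L := Module.Finite.of_basis B
  have hM := Certificate.normalizerOfRadical_eq hbr hadm hZ hc hr
  have hc' := hc
  simp only [Certificate.checkNormalizer, Bool.and_eq_true, List.all_eq_true, forceList_eq,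
    beq_iff_eq, decide_eq_true_eq] at hc'
  obtain ⟨⟨⟨hE, hadmA⟩, -⟩, ⟨⟨-, hEM⟩, hlen⟩, hlt⟩ := hc'
  have hrank : Module.finrank k (normalizerOfRadical (k := k) (sumVec B c.e)) = c.dim := by
    change Module.finrank k (normalizerOfRadical (k := k) (sumVec B c.e)).toSubmodule = c.dim
    rw [hM]
    have := (finrank_spanList_of_isEchelon hEM fun p _ => reads_toVec B p.2).2
    rw [withPivots_map_snd] at this
    rw [Certificate.normalizerSpan, this, ← hlen]
    simp [withPivots]
  refine ⟨hrank, ?_, ?_⟩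
  -- Properness follows from the dimension: `dim < D` is part of the check.
  · intro htop
    have : Module.finrank k (⊤ : LieSubalgebra k L) = Module.finrank k L :=
      finrank_top k L
    rw [← htop, hrank, Module.finrank_eq_card_basis B, Fintype.card_fin] at this
    omega
  intro N hN
  have hMN : c.normalizerSpan br B ≤ N.toSubmodule := by
    rw [← hM]
    exact hN.le
  have hnot : ¬ N.toSubmodule ≤ c.normalizerSpan br B := by
    rw [← hM]
    exact hN.not_ge
  -- The check evaluates the leading bits once and for all; the resulting list of pairs is the usual
  -- one.
  have hzip : (List.map Nat.log2 (c.normalizer br D)).zip (c.normalizer br D) =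
      withPivots (c.normalizer br D) := by
    rw [withPivots, List.zip_map_left]
    induction c.normalizer br D with
    | nil => rfl
    | cons a l ih => simpa using ih
  simp only [Certificate.checkMaximal, Bool.and_eq_true, List.all_eq_true, forceList_eq, force_eq,
    hzip] at hm
  obtain ⟨⟨h1, h2⟩, h3⟩ := hm
  have hnorm : ∀ p, c.normalizesRadical adm br p = true →
      (∀ i ∈ p, adm i = true) ∧ sumVec B p ∈ N := by
    intro p hp
    simp only [Certificate.normalizesRadical, Bool.and_eq_true, List.all_eq_true,
      beq_iff_eq] at hp
    refine ⟨hp.1, hMN (Certificate.mem_normalizer hbr hc ?_)⟩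
    have he : c.e ∈ c.e :: c.rad := List.mem_cons_self
    rw [← lie_skew, hbr.lieSum hp.1 fun i hi => hadm i (hadmA c.e he i hi)]
    obtain ⟨y, hy, h⟩ := exists_reduce (k := k) (toVec_xor B) c.radical (lieSum br p c.e)
    rw [h, hp.2 c.e he, toVec_zero, zero_add]
    rw [Certificate.radical_map_snd] at hy
    exact Submodule.neg_mem _ hy
  obtain ⟨x, hxN, hxM, hops⟩ := exists_lie_mem hbr (ops := c.maxOps) (W := N.toSubmodule)
    (fun p hp => (hnorm p (h1 p hp).2).1) (fun p hp => (h1 p hp).1)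
    (fun p hp x hx => N.lie_mem (hnorm p (h1 p hp).2).2 hx) hnot
  have hxK := mem_span_kernelColumns hbr hEM (ops := c.maxOps) (ops' := []) (x := x)
    (by
      intro p hp
      rw [List.append_nil] at hp
      exact (hnorm p (h1 p hp).2).1)
    (by
      intro p hp
      rw [withPivots_map_snd]
      exact hops p hp)
  rw [List.append_nil] at hxK
  have hxs := mem_sup_of_reduce (E := withPivots (c.normalizer br D)) (v := c.maxTop)
    (fun m hm => by simpa using h2 m hm) hxK
  rw [withPivots_map_snd] at hxs
  have htop := mem_of_mem_span_sup hMN hxs hxN hxM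
  refine hgen N (mem_of_checkWords hbr (W := N.toSubmodule)
    (fun p _ hp x hx => N.lie_mem (hnorm p hp).2 hx) (fun x hx y hy => N.lie_mem hx hy)
    (fun r hr => (hnorm r hr).2) (by simpa using htop) h3)

end

end BitMask

/-! ## Root tables -/

namespace ChevalleyAlgebra

theorem form_single_left {n : ℕ} (C : Matrix (Fin n) (Fin n) ℤ) (i : Fin n) (a : Fin n → ℤ) :
    dotProduct (Pi.single i 1) (C.mulVec a) = C.mulVec a i := by
  rw [single_one_dotProduct]

theorem mulVec_single_self {n : ℕ} (C : Matrix (Fin n) (Fin n) ℤ) [IsADECartan C] (i : Fin n) :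
    C.mulVec (Pi.single i 1) i = 2 := by
  rw [Matrix.mulVec_single_one]
  exact IsADECartan.diag (C := C) i

theorem sum_natAbs_lt {n : ℕ} {a b : Fin n → ℤ} (i : Fin n) (hi : (b i).natAbs < (a i).natAbs)
    (h : ∀ j, j ≠ i → b j = a j) : ∑ j, (b j).natAbs < ∑ j, (a j).natAbs := by
  refine Finset.sum_lt_sum (fun j _ => ?_) ⟨i, Finset.mem_univ _, hi⟩
  by_cases hj : j = i
  · rw [hj]
    exact hi.le
  · rw [h j hj]

/-- Every root is joined to a simple root or its negative by a chain of roots whose steps are simple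
roots. It serves both to generate the Lie algebra and to show that a table closed under such steps
misses no root. -/
theorem root_induction {n : ℕ} {C : Matrix (Fin n) (Fin n) ℤ} [IsADECartan C]
    {P : (Fin n → ℤ) → Prop} (hpos : ∀ i, P (Pi.single i 1)) (hneg : ∀ i, P (-Pi.single i 1))
    (hadd : ∀ a, IsRoot C a → P a → ∀ i, C.mulVec a i = -1 → P (a + Pi.single i 1))
    (hsub : ∀ a, IsRoot C a → P a → ∀ i, C.mulVec a i = 1 → P (a - Pi.single i 1))
    (a : Fin n → ℤ) (ha : IsRoot C a) : P a := by
  induction hm : ∑ j, (a j).natAbs using Nat.strong_induction_on generalizing a with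
  | _ m ih =>
    have hsum : 0 < ∑ i, a i * C.mulVec a i := by
      have : dotProduct a (C.mulVec a) = 2 := ha
      rw [dotProduct] at this
      omega
    -- As `(a | a) = ∑ aᵢ (a | αᵢ)` is positive, some term is: `aᵢ` and `(a | αᵢ)` have the same
    -- sign, and moving the `i`-th coordinate towards zero gives a root again unless `a = ±αᵢ`.
    obtain ⟨i, -, hi⟩ := Finset.exists_lt_of_sum_lt
      (s := Finset.univ) (f := fun _ : Fin n => (0 : ℤ)) (by simpa using hsum)
    let r : Root C := ⟨a, ha⟩
    let s : Root C := simpleRoot i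
    have hs : s.1 = Pi.single i 1 := rfl
    have hform : dotProduct s.1 (C.mulVec a) = C.mulVec a i := form_single_left C i a
    have hform' : dotProduct (negRoot s).1 (C.mulVec a) = -C.mulVec a i := by
      rw [← hform]
      exact neg_dotProduct _ _
    have hb := form_bounds s r
    rw [hform] at hb
    rcases lt_or_gt_of_ne (left_ne_zero_of_mul hi.ne') with h0 | h0
    · have h1 : C.mulVec a i < 0 := neg_of_mul_pos_right hi h0.le
      obtain h2 | h2 : C.mulVec a i = -1 ∨ C.mulVec a i = -2 := by omega
      · have hroot : IsRoot C (s.1 + r.1) := (isRoot_add_iff s r).2 (hform.trans h2)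
        rw [add_comm] at hroot
        have hlt : ∑ j, ((r.1 + s.1) j).natAbs < m := by
          rw [← hm]
          refine sum_natAbs_lt i ?_ fun j hj => ?_
          · change (a i + (Pi.single i 1 : Fin n → ℤ) i).natAbs < _
            rw [Pi.single_eq_same]
            omega
          · change a j + (Pi.single i 1 : Fin n → ℤ) j = a j
            rw [Pi.single_eq_of_ne hj, add_zero]
        have := hsub _ hroot (ih _ hlt _ hroot rfl) i (by
          rw [Matrix.mulVec_add, Pi.add_apply, hs, mulVec_single_self]
          change C.mulVec a i + 2 = 1
          omega)
        rwa [hs, add_sub_cancel_right] at this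
      · have := (add_eq_zero_iff s r).2 (hform.trans h2)
        rw [show a = -Pi.single i 1 from (neg_eq_of_add_eq_zero_right this).symm]
        exact hneg i
    · have h1 : 0 < C.mulVec a i := pos_of_mul_pos_right hi h0.le
      obtain h2 | h2 : C.mulVec a i = 1 ∨ C.mulVec a i = 2 := by omega
      · have hroot : IsRoot C ((negRoot s).1 + r.1) :=
          (isRoot_add_iff _ r).2 (hform'.trans (by rw [h2]))
        rw [add_comm] at hroot
        have hlt : ∑ j, ((r.1 + (negRoot s).1) j).natAbs < m := by
          rw [← hm]
          refine sum_natAbs_lt i ?_ fun j hj => ?_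
          · change (a i + -(Pi.single i 1 : Fin n → ℤ) i).natAbs < _
            rw [Pi.single_eq_same]
            omega
          · change a j + -(Pi.single i 1 : Fin n → ℤ) j = a j
            rw [Pi.single_eq_of_ne hj, neg_zero, add_zero]
        have hns : (negRoot s).1 = -Pi.single i 1 := rfl
        have := hadd _ hroot (ih _ hlt _ hroot rfl) i (by
          rw [Matrix.mulVec_add, Pi.add_apply, hns, Matrix.mulVec_neg, Pi.neg_apply,
            mulVec_single_self]
          change C.mulVec a i + -2 = -1
          omega)
        rwa [hns, neg_add_cancel_right] at this
      · have := (add_eq_zero_iff (negRoot s) r).2 (hform'.trans (by rw [h2]))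
        have h3 : -Pi.single i 1 + a = 0 := this
        rw [show a = Pi.single i 1 from by rw [← sub_eq_zero, ← h3]; abel]
        exact hpos i

theorem eq_top_of_simple_mem (k : Type*) [Field k] [CharP k 2] {n : ℕ}
    {C : Matrix (Fin n) (Fin n) ℤ} [IsADECartan C] {N : LieSubalgebra k (ChevalleyAlgebra k C)}
    (hpos : ∀ i, eAux k C (Pi.single i 1) ∈ N) (hneg : ∀ i, eAux k C (-Pi.single i 1) ∈ N) :
    N = ⊤ := by
  have hroot : ∀ a, IsRoot C a → eAux k C a ∈ N := by
    refine root_induction hpos hneg (fun a ha hN i hi => ?_) (fun a ha hN i hi => ?_)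
    · have h1 : dotProduct a (C.mulVec (simpleRoot (C := C) i).1) = -1 := by
        rw [form_comm]
        exact (form_single_left C i a).trans hi
      have h2 := N.lie_mem hN (hpos i)
      rw [show eAux k C a = e k ⟨a, ha⟩ from eAux_root k ⟨a, ha⟩,
        show eAux k C (Pi.single i 1) = e k (simpleRoot i) from eAux_root k (simpleRoot i),
        lie_def, bracket_e_e, if_neg] at h2
      · exact h2
      · rw [add_eq_zero_iff, h1]
        decide
    · have h1 : dotProduct a (C.mulVec (negRoot (simpleRoot (C := C) i)).1) = -1 := by
        rw [form_comm]
        have := form_single_left C i a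
        change dotProduct (-Pi.single i 1) _ = _
        rw [neg_dotProduct, this, hi]
      have h2 := N.lie_mem hN (hneg i)
      rw [show eAux k C a = e k ⟨a, ha⟩ from eAux_root k ⟨a, ha⟩,
        show eAux k C (-Pi.single i 1) = e k (negRoot (simpleRoot i)) from
          eAux_root k (negRoot (simpleRoot i)),
        lie_def, bracket_e_e, if_neg] at h2
      · rwa [sub_eq_add_neg]
      · rw [add_eq_zero_iff, h1]
        decide
  rw [eq_top_iff]
  intro x _
  induction x using induction_basis with
  | h0 => exact N.zero_mem
  | hadd x y hx hy => exact N.add_mem (hx trivial) (hy trivial)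
  | hsmul c x hx => exact N.smul_mem c (hx trivial)
  | hb i =>
    rcases i with i | α
    -- The Cartan elements are obtained as `[e_{αᵢ}, e_{-αᵢ}] = hᵢ`.
    · have h1 := N.lie_mem (hpos i) (hneg i)
      rw [show eAux k C (Pi.single i 1) = e k (simpleRoot i) from eAux_root k (simpleRoot i),
        show eAux k C (-Pi.single i 1) = e k (negRoot (simpleRoot i)) from
          eAux_root k (negRoot (simpleRoot i)), lie_def, bracket_e_e, if_pos] at h1
      · have h2 : coroot k (simpleRoot (C := C) i) = h k C i := by
          rw [coroot, Finset.sum_eq_single i]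
          · simp [simpleRoot]
          · intro j _ hj
            simp [simpleRoot, Pi.single_eq_of_ne hj]
          · simp
        rw [h2] at h1
        exact h1
      · exact add_neg_cancel _
    · have := hroot α.1 α.2
      rwa [eAux_root] at this

end ChevalleyAlgebra

/-! ### Roots encoded in base 32, and the bracket computed from a table -/

namespace RootTable

open BitMask

/-- The exponent of the weight of a coordinate in the encoding of roots. -/
def expo (i : ℕ) : ℕ := [0, 4, 7, 1, 5, 2, 6, 3].getD i 0

/-- The sign of the weight of a coordinate in the encoding of roots. -/
def sgn (i : ℕ) : ℤ := [1, -1, 1, 1, 1, 1, -1, -1].getD i 0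

/-- The weight of a coordinate in the encoding of roots. -/
def weight (i : ℕ) : ℤ := sgn i * 32 ^ expo i

/-- The code of the zero vector: all digits to the base `32` are `16`. -/
def zeroCode : ℕ := 567489872400

/-- The `t`-th entry of a table of numbers with forty bits. -/
def code (T t : ℕ) : ℕ := T >>> (40 * t) % 2 ^ 40

/-- The vector encoded by the `t`-th entry. -/
def vec (T n t : ℕ) (i : Fin n) : ℤ :=
  sgn i * (((code T t >>> (5 * expo i) % 32 : ℕ) : ℤ) - 16)

/-- Binary search in an ascending table. -/
def search (T s : ℕ) : ℕ → ℕ → ℕ → ℕ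
  | 0, lo, _ => lo
  | f + 1, lo, hi => force ((lo + hi) / 2) fun m =>
      cond (Nat.ble (code T m) s) (search T s f m hi) (search T s f lo m)

/-- The position of a number in a table with `2 * H + n` entries. -/
def find (T H n s : ℕ) : ℕ := search T s 8 0 (2 * H + n)

/-- The positions of roots in the table: the positions of the Cartan elements lie in between. -/
def isRootPos (H n t : ℕ) : Bool := Nat.blt t (2 * H + n) && (Nat.blt t H || Nat.ble (H + n) t)

section

variable (T H : ℕ) {n : ℕ} (C : Matrix (Fin n) (Fin n) ℤ)

/-- The coroot of the root in position `i`. -/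
def corootMask (i : ℕ) : List (Fin n) → ℕ
  | [] => 0
  | l :: ls => (cond (vec T n i l % 2 == 0) 0 (bit (H + l))) ^^^ corootMask i ls

/-- The bracket of the root vector in position `i` with the basis element in position `j`. -/
def lie (i j : ℕ) : ℕ :=
  if h : H ≤ j ∧ j < H + n then
    cond (C.mulVec (vec T n i) ⟨j - H, by omega⟩ % 2 == 0) 0 (bit i)
  else force (code T i + code T j) fun s =>
    cond (s == 2 * zeroCode) (corootMask T H i (List.finRange n))
      (force (find T H n (s - zeroCode)) fun t =>
        -- The comparison adds `zeroCode` back, so a truncated subtraction in `s - zeroCode` cannot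
        -- produce a false hit.
        cond (isRootPos H n t && code T t + zeroCode == s) (bit t) 0)

/-- The number `s` is found in the table. -/
def contains (T H n : ℕ) (s : ℤ) : Bool :=
  isRootPos H n (find T H n s.toNat) && (code T (find T H n s.toNat) : ℤ) == s

/-- The table lists roots, correctly encoded. -/
def checkRoots : Bool :=
  (List.range (2 * H + n)).all fun t => !isRootPos H n t ||
    (dotProduct (vec T n t) (C.mulVec (vec T n t)) == 2 &&
      (code T t : ℤ) == zeroCode + ∑ i, vec T n t i * weight i &&
      find T H n (code T t) == t &&
      (List.finRange n).all fun i => decide (-9 ≤ vec T n t i) && decide (vec T n t i ≤ 9))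

/-- The table is closed under adding and subtracting simple roots. -/
def checkClosed : Bool :=
  ((List.finRange n).all fun i => contains T H n (zeroCode + weight i) &&
    contains T H n (zeroCode - weight i)) &&
  (List.range (2 * H + n)).all fun t => !isRootPos H n t ||
    (List.finRange n).all fun i =>
      (C.mulVec (vec T n t) i != -1 || contains T H n (code T t + weight i)) &&
      (C.mulVec (vec T n t) i != 1 || contains T H n (code T t - weight i))

/-- The table lists the roots with respect to the Cartan matrix `C`. -/
structure Valid : Prop where
  roots : checkRoots T H C = true
  closed : checkClosed T H C = true
  inj : ∀ d : Fin n → ℤ, (∀ i, -28 ≤ d i ∧ d i ≤ 28) → ∑ i, d i * weight i = 0 → d = 0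

end

end RootTable

namespace RootTable

open BitMask

/-- The encoded roots of type `E₆`. -/
def table6 : ℕ :=
  946306416591891300187073665733603293049928602533943723407453662736553414534317719417491696262631076300842113291569688210597926800385063198379821613299312962371826098685863483144062157748702176816418896990017203568230022850954052684383353218132248044143186307999714875507377389625005570277009867228070121276044319712936226112393404631590797085611595985661998406027513632269840958802320182277134890200989959420973656120953298513718065784596347320954057330877088465087844445695507206381320266751089196652220712145566015687681510313103285347222801623396712302619911895609134858488956202989260198024805689345351776405649834515541664849302485226222325592950899406838953684562472927902227321133614612745932771843983953595721072146581136849664792273708559091981593650838145244993783263487282091939068843376251754061654077112590660932469661520402948909806031075109505422341008639413731873578857391582422995956072875458849616160094971996059647622575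

/-- The certificate for type `E₆`. -/
def certificate6 : Certificate where
  e := [42, 43, 44]
  rad := [[66], [18]]
  center := []
  dim := 43
  radOps := [[60, 61, 63], [46], [44], [50, 51], [56, 57], [43]]
  radTop := [77]
  radWords :=
    [([8, 9], [77], [62, 65]), ([12, 13, 15], [77], [68, 69]), ([12, 13, 15], [62, 65], [36,
    41]), ([26, 27], [68, 69], [56, 57]), ([20, 21], [68, 69], [50, 51]), ([26, 27], [36, 41],
    [26, 27]), ([20, 21], [36, 41], [20, 21]), ([26, 27], [20, 21], [8, 9])]
  perfect :=
    [([8, 9], [56, 57], [26, 27]), ([26, 27], [68, 69], [56, 57]), ([56, 57], [50, 51], [68,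
    69]), ([68, 69], [20, 21], [50, 51]), ([50, 51], [8, 9], [20, 21]), ([20, 21], [26, 27], [8,
    9])]
  maxOps := [[60, 61, 63], [46], [48], [56, 57], [50, 51]]
  maxTop := [76]
  maxWords :=
    [([4], [76], [51]), ([6], [76], [56]), ([8, 9], [76], [60, 63]), ([12, 13, 15], [76], [67]),
    ([26, 27], [51], [40, 41]), ([8, 9], [56], [27]), ([20, 21], [56], [36, 38]), ([12, 13, 15],
    [60, 63], [33, 35]), ([20, 21], [60, 63], [47]), ([20, 21], [67], [49]), ([26, 27], [67],
    [55]), ([33, 35], [40, 41], [33]), ([33, 35], [36, 38], [35]), ([26, 27], [47], [31]), ([27],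
    [49], [34])]
  gens := [[42], [35], [31], [46], [55], [22], [43], [34], [49], [28], [44], [33]]

/-- The encoded roots of type `E₇`. -/
def table7 : ℕ :=
  1837336080289736312222496336810935670995109620690631610154988487324123849136360684564837159575978142972925291410140508925935412589591283667954106378239998342131283923902206193296749092143811981321967748173087233320128530143817590993741122107213988246051042129217172097430526124685733505593000149942506487327374467141082814175515708719538866970776908742267943701626411534674920339620732493984257383172018804167608156183142719114845092242742747153495279646652343262197087349624918938393706374097588514049020303449541099492260293510509017875768933679793986472518076667469071582699793616277305916697459275606724602512269947483426308391054365759292100632077532588921424407045047504373621510477201062576447291301303672312216690197246305876098194041314028510656169432229037743232363282187320434296474631335452522046426399596526197862589206229637931257952497764209515742986061501647105993814472688304276493659497123637053393169644904390824697256058619272399631110021599616298650323916325076660867230891753796685410492010383113356800775093933404804732131636327304021876801697043877404798568552089790313719221380172820500490172549361239576971127908871715686437377835137266359498319719478290986470435736814510866277777497996846648840937664101171529956943525584973283418640772797441919555473861527656757447029856346540614525742879676599118227148485949845264194759753001494258455055031541422958055501966507203569131727789641767521427113984682464365002931385648910154574367129187779084529123265389408614099355273864840285964714387131187962863770230847008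03484263888118281685445040628955878668330841239540504858212750

/-- The certificate for type `E₇`. -/
def certificate7 : Certificate where
  e := [70, 71, 72]
  rad := [[109], [30]]
  center := [[64, 67, 69]]
  dim := 74
  radOps := [[103, 104, 106], [74], [87, 88], [82], [99, 100], [78, 79]]
  radTop := [132]
  radWords :=
    [([24, 25, 27], [132], [120, 121]), ([7], [132], [97]), ([11, 12], [132], [105, 107]), ([16],
    [132], [115]), ([38, 39], [120, 121], [99, 100]), ([24, 25, 27], [97], [53, 54]), ([24, 25,
    27], [105, 107], [66, 68]), ([24, 25, 27], [115], [78, 79]), ([44, 45], [120, 121], [111,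
    112]), ([32, 33], [53, 54], [20, 21]), ([32, 33], [66, 68], [32, 33])]
  perfect :=
    [([111, 112], [53, 54], [99, 100]), ([99, 100], [20, 21], [53, 54]), ([53, 54], [32, 33],
    [20, 21]), ([20, 21], [78, 79], [32, 33]), ([32, 33], [111, 112], [78, 79]), ([78, 79], [99,
    100], [111, 112])]
  maxOps := [[87, 88], [103, 104, 106], [72], [83], [93, 94]]
  maxTop := [131]
  maxWords :=
    [([3], [131], [88]), ([4], [131], [90]), ([6], [131], [94]), ([7], [131], [96]), ([11, 12],
    [131], [104, 106]), ([16], [131], [114]), ([24, 25, 27], [131], [119]), ([24, 25, 27], [88],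
    [47]), ([7], [90], [17]), ([38, 39], [94], [64, 65, 69]), ([44, 45], [94], [79]), ([24, 25,
    27], [96], [52]), ([32, 33], [96], [58]), ([24, 25, 27], [104, 106], [60, 61]), ([24, 25,
    27], [114], [77]), ([38, 39], [119], [98]), ([114], [17], [62]), ([79], [52], [61]), ([60,
    61], [64, 65, 69], [60])]
  gens := [[70], [62], [58], [74], [98], [34], [71], [61], [77], [55], [72], [60], [47], [85]]

/-- The encoded roots of type `E₈`. -/
def table8 : ℕ :=
  1055064686313151478043523886721882203883639756269306752638216737859364821989191163694918553384432450083010560272583635486300659216512305083942940878960786098732493014990775441771428086934574764384392521962764885706473710419719259996447603449599433126090333306893946391708736794301998489217778843182170763183543882245637425877037307094710326600981652674708137829986270000806687505001487412311766897627979459174354036749009057784295326607108684596837548364528189112336720916047272774948197759344463853937713577227425001800016107529255133740490256874621725423042969004287658743608052622278453477924722627555357332411152514105245251487646340321579349351323974088984297304902177815840581727652090543893202988252792538851922431532545409806533549029612627126514733272758849492583144888915476615893388463796804015261827929905242853566776808770452490681749764223250239322023206323393205051834469663745432421002453303172583810493012482161086572398089990204759066077068746639439635885334162109079100712479244503536663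7891628074905576664241119342531929323156778478329372050013081005323167624686967566101686652804503208008730480139622176092854752629373549624187532026276639142994137668312535542722516757093363001523620422691713089515548646608379405944820491858997479374214179143166994606051564330886786410442402696371842869700272551849989026406108114905908937887816327510172592479822751420500836649541328392687823514361176354428992329523086976823317448390613413906602004732487034142086455251017150055350998095011763460108650074883182091412703577063693217288731983297118469856858243634413146206417784468656290326845762004745509067473275728995126313796674501185124021598935893053225635814825387199132171176405662739497071898803622020077388651141512625733743707404053269711045047116224579110295235453837959847511366798565363074124261882340570753532600106979894798880336177802696945742631406084172756424051580424246284530418332761499865041344332349177489725638282973332453003353625643859280904350548618649278363087404980250392458178163874799250759043360690081536649928255067391661354247748516543655108796100744316690812973267561875657552192307516377119075944547826014016347517313818146950034890770489842757472622633149090481366826106520820754644246035021693389758046573604794643952832324516509976403859976254883942780418677122634225205527055436438741366754274987295449833765690277233763019681242215156959498710982006780647905616197726514008384597761109638411769300667780064121740975197379910995874963107824901561464382012404515843286228941225344459845490840521552430643977689198000846212685750629036222078544566030007107833186443973390237983298838320407170375510487604187824583062616461923770996719357441258902812501800627051737624297836431907029847922563535137623150918577222358809246609966168671450472404296807720324041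752116669050108845574743695428499500185045134039654544169994746626168662952481849996771234874598606289407189312362734961331760799521133853902495215082896040248214794707809558538531150

/-- The certificate for type `E₈`. -/
def certificate8 : Certificate where
  e := [128, 129, 130]
  rad := [[185], [69]]
  center := []
  dim := 141
  radOps :=
    [[153, 154], [187, 188], [143], [137, 138], [194], [131], [147], [179, 180, 182], [135]]
  radTop := [247]
  radWords :=
    [([6], [247], [149]), ([2], [247], [135]), ([33, 34], [247], [217]), ([63, 64, 66], [247],
    [234, 235]), ([46], [247], [223]), ([63, 64, 66], [149], [93, 94]), ([63, 64, 66], [135],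
    [71, 72]), ([63, 64, 66], [217], [165, 166]), ([77, 78], [234, 235], [209, 210]), ([63, 64,
    66], [223], [175, 176]), ([109, 110], [93, 94], [81, 82]), ([81, 82], [71, 72], [37, 38])]
  perfect :=
    [([175, 176], [37, 38], [81, 82]), ([81, 82], [71, 72], [37, 38]), ([37, 38], [165, 166],
    [71, 72]), ([71, 72], [209, 210], [165, 166]), ([165, 166], [175, 176], [209, 210]), ([209,
    210], [81, 82], [175, 176])]
  maxOps := [[157, 158], [144], [128], [153, 154], [179, 180, 182], [137, 138]]
  maxTop := [246]
  maxWords :=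
    [([2], [246], [134]), ([4], [246], [137]), ([6], [246], [148]), ([8], [246], [165]), ([12,
    13], [246], [179, 180]), ([18, 19], [246], [190]), ([23], [246], [199]), ([46], [246],
    [222]), ([23], [134], [24]), ([109, 110], [134], [114]), ([63, 64, 66], [137], [74]), ([109,
    110], [148], [142]), ([63, 64, 66], [165], [104]), ([109, 110], [179, 180], [172]), ([63, 64,
    66], [190], [136]), ([27], [199], [100]), ([63, 64, 66], [222], [174]), ([222], [24], [117]),
    ([142], [104], [118]), ([74], [172], [119])]
  gens :=
    [[128], [119], [114], [133], [174], [73], [129], [118], [136], [111], [130], [117], [100],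
    [147], [116], [131]]

end RootTable

/-! ### A valid table yields the Chevalley basis and its brackets -/

namespace RootTable

open BitMask ChevalleyAlgebra

variable {T H n : ℕ} {C : Matrix (Fin n) (Fin n) ℤ}

theorem isRootPos_iff {t : ℕ} :
    isRootPos H n t = true ↔ t < 2 * H + n ∧ ¬ (H ≤ t ∧ t < H + n) := by
  rw [isRootPos, Bool.and_eq_true, Bool.or_eq_true, Nat.blt_eq, Nat.blt_eq, Nat.ble_eq]
  omega

theorem contains_iff {s : ℤ} (h : contains T H n s = true) :
    ∃ t, isRootPos H n t = true ∧ (code T t : ℤ) = s := by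
  rw [contains, Bool.and_eq_true, beq_iff_eq] at h
  exact ⟨_, h⟩

namespace Valid

variable (hv : Valid T H C)
include hv

theorem root_data {t : ℕ} (ht : isRootPos H n t = true) :
    IsRoot C (vec T n t) ∧ (code T t : ℤ) = zeroCode + ∑ i, vec T n t i * weight i ∧
      find T H n (code T t) = t ∧ ∀ i, -9 ≤ vec T n t i ∧ vec T n t i ≤ 9 := by
  have h := hv.roots
  rw [checkRoots, List.all_eq_true] at h
  have h1 := h t (List.mem_range.2 (isRootPos_iff.1 ht).1)
  simp only [ht, Bool.not_true, Bool.false_or, Bool.and_eq_true, beq_iff_eq, List.all_eq_true,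
    decide_eq_true_eq, List.mem_finRange, forall_const] at h1
  exact ⟨h1.1.1.1, h1.1.1.2, h1.1.2, h1.2⟩

/-- Codes determine vectors with small coordinates. Table entries are bounded by 9, and 19 leaves
room for a sum of two of them; the difference is then bounded by `9 + 19 = 28`, the range of the
injectivity hypothesis. -/
theorem vec_eq_of_code {t : ℕ} (ht : isRootPos H n t = true) {a : Fin n → ℤ}
    (ha : ∀ i, -19 ≤ a i ∧ a i ≤ 19) (h : (code T t : ℤ) = zeroCode + ∑ i, a i * weight i) :
    vec T n t = a := by
  obtain ⟨-, h1, -, h2⟩ := hv.root_data ht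
  rw [← sub_eq_zero]
  refine hv.inj _ (fun i => ?_) ?_
  · have h3 := ha i
    have h4 := h2 i
    rw [Pi.sub_apply]
    omega
  · simp only [Pi.sub_apply, sub_mul, Finset.sum_sub_distrib]
    linarith

theorem vec_injective {t u : ℕ} (ht : isRootPos H n t = true) (hu : isRootPos H n u = true)
    (h : vec T n t = vec T n u) : t = u := by
  obtain ⟨-, h1, h2, -⟩ := hv.root_data ht
  obtain ⟨-, h3, h4, -⟩ := hv.root_data hu
  rw [h, ← h3] at h1
  rw [← h2, ← h4, Int.ofNat.inj h1]

theorem code_add {t u : ℕ} (ht : isRootPos H n t = true) (hu : isRootPos H n u = true) :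
    (code T t : ℤ) + code T u =
      2 * zeroCode + ∑ i, (vec T n t + vec T n u) i * weight i := by
  rw [(hv.root_data ht).2.1, (hv.root_data hu).2.1]
  simp only [Pi.add_apply, add_mul, Finset.sum_add_distrib]
  ring

omit hv in
theorem sum_single_weight (i : Fin n) :
    ∑ j, (Pi.single i 1 : Fin n → ℤ) j * weight j = weight i := by
  rw [Finset.sum_eq_single i]
  · simp
  · intro j _ hj
    simp [Pi.single_eq_of_ne hj]
  · simp

omit hv in
theorem single_bounds (i j : Fin n) :
    0 ≤ (Pi.single i 1 : Fin n → ℤ) j ∧ (Pi.single i 1 : Fin n → ℤ) j ≤ 1 := by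
  rw [Pi.single_apply]
  split_ifs <;> decide

theorem vec_find_pos (i : Fin n) :
    isRootPos H n (find T H n (zeroCode + weight i).toNat) = true ∧
      vec T n (find T H n (zeroCode + weight i).toNat) = Pi.single i 1 := by
  have hc := hv.closed
  simp only [checkClosed, contains, Bool.and_eq_true, List.all_eq_true, beq_iff_eq] at hc
  obtain ⟨⟨h1, h2⟩, -⟩ := hc.1 i (List.mem_finRange i)
  refine ⟨h1, hv.vec_eq_of_code h1 (fun j => ?_) (by rw [h2, sum_single_weight])⟩
  have := single_bounds i j
  omega

theorem vec_find_neg (i : Fin n) :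
    isRootPos H n (find T H n (zeroCode - weight i).toNat) = true ∧
      vec T n (find T H n (zeroCode - weight i).toNat) = -Pi.single i 1 := by
  have hc := hv.closed
  simp only [checkClosed, contains, Bool.and_eq_true, List.all_eq_true, beq_iff_eq] at hc
  obtain ⟨-, h1, h2⟩ := hc.1 i (List.mem_finRange i)
  refine ⟨h1, hv.vec_eq_of_code h1 (fun j => ?_) ?_⟩
  · have := single_bounds i j
    rw [Pi.neg_apply]
    omega
  · simp only [Pi.neg_apply, neg_mul, Finset.sum_neg_distrib]
    rw [h2, sum_single_weight, sub_eq_add_neg]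

/-- Completeness of the table: it contains the simple roots and their negatives and is closed under
the steps of `root_induction`. -/
theorem exists_vec_eq [IsADECartan C] (a : Fin n → ℤ) (ha : IsRoot C a) :
    ∃ t, isRootPos H n t = true ∧ vec T n t = a := by
  have hc := hv.closed
  rw [checkClosed, Bool.and_eq_true, List.all_eq_true, List.all_eq_true] at hc
  obtain ⟨-, h1⟩ := hc
  have h1' : ∀ t, isRootPos H n t = true → ∀ i : Fin n,
      (C.mulVec (vec T n t) i = -1 → contains T H n (code T t + weight i) = true) ∧
      (C.mulVec (vec T n t) i = 1 → contains T H n (code T t - weight i) = true) := by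
    intro t ht i
    have h2 := h1 t (List.mem_range.2 (isRootPos_iff.1 ht).1)
    simp only [ht, Bool.not_true, Bool.false_or, List.all_eq_true, List.mem_finRange,
      forall_const, Bool.and_eq_true, Bool.or_eq_true, bne_iff_ne] at h2
    exact ⟨fun h => (h2 i).1.resolve_left fun h' => h' h,
      fun h => (h2 i).2.resolve_left fun h' => h' h⟩
  refine root_induction (C := C) (P := fun a => ∃ t, isRootPos H n t = true ∧ vec T n t = a)
    (fun i => ?_) (fun i => ?_) (fun a _ h i hi => ?_)
    (fun a _ h i hi => ?_) a ha
  · exact ⟨_, hv.vec_find_pos i⟩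
  · exact ⟨_, hv.vec_find_neg i⟩
  · obtain ⟨t, ht, rfl⟩ := h
    obtain ⟨-, h3, -, h4⟩ := hv.root_data ht
    obtain ⟨u, hu, hc⟩ := contains_iff ((h1' t ht i).1 hi)
    refine ⟨u, hu, hv.vec_eq_of_code hu (fun j => ?_) ?_⟩
    · have := single_bounds i j
      have := h4 j
      rw [Pi.add_apply]
      omega
    · simp only [Pi.add_apply, add_mul, Finset.sum_add_distrib]
      rw [hc, sum_single_weight, h3, add_assoc]
  · obtain ⟨t, ht, rfl⟩ := h
    obtain ⟨-, h3, -, h4⟩ := hv.root_data ht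
    obtain ⟨u, hu, hc⟩ := contains_iff ((h1' t ht i).2 hi)
    refine ⟨u, hu, hv.vec_eq_of_code hu (fun j => ?_) ?_⟩
    · have := single_bounds i j
      have := h4 j
      rw [Pi.sub_apply]
      omega
    · simp only [Pi.sub_apply, sub_mul, Finset.sum_sub_distrib]
      rw [hc, sum_single_weight, h3, add_sub_assoc]

omit hv in
theorem isRootPos_of_not {t : Fin (2 * H + n)} (h : ¬ (H ≤ t.1 ∧ t.1 < H + n)) :
    isRootPos H n t = true := isRootPos_iff.2 ⟨t.2, h⟩

/-- The element of the Chevalley basis in a given position. -/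
def index (t : Fin (2 * H + n)) : ChevalleyIndex C :=
  if h : H ≤ t.1 ∧ t.1 < H + n then .inl ⟨t.1 - H, by omega⟩
  else .inr ⟨vec T n t, (hv.root_data (isRootPos_of_not h)).1⟩

theorem index_bijective [IsADECartan C] : Function.Bijective hv.index := by
  constructor
  · intro t u h
    simp only [index] at h
    split_ifs at h with h1 h2 h2
    · have := Fin.val_eq_of_eq (Sum.inl_injective h)
      exact Fin.ext (by simp only at this; omega)
    · exact Fin.ext (hv.vec_injective (isRootPos_of_not h1) (isRootPos_of_not h2)
        (congrArg Subtype.val (Sum.inr_injective h)))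
  · rintro (i | α)
    · refine ⟨⟨H + i.1, by omega⟩, ?_⟩
      rw [index, dif_pos (by simp)]
      simp
    · obtain ⟨t, ht, hα⟩ := hv.exists_vec_eq α.1 α.2
      have h1 := isRootPos_iff.1 ht
      refine ⟨⟨t, h1.1⟩, ?_⟩
      rw [index, dif_neg h1.2]
      exact congrArg Sum.inr (Subtype.ext hα)

variable (k : Type*) [Field k]

/-- The Chevalley basis, indexed by positions. -/
noncomputable def basis [IsADECartan C] :
    Module.Basis (Fin (2 * H + n)) k (ChevalleyAlgebra k C) :=
  (ChevalleyAlgebra.basis k C).reindex (Equiv.ofBijective _ hv.index_bijective).symm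

variable [IsADECartan C]

theorem toVec_bit_root {t : ℕ} (ht : isRootPos H n t = true) :
    toVec (hv.basis k) (bit t) = e k ⟨vec T n t, (hv.root_data ht).1⟩ := by
  have h1 := isRootPos_iff.1 ht
  have := toVec_bit (hv.basis k) ⟨t, h1.1⟩
  rw [this, basis, Module.Basis.reindex_apply, Equiv.symm_symm, Equiv.ofBijective_apply, index,
    dif_neg h1.2]
  rfl

theorem toVec_bit_cartan (i : Fin n) : toVec (hv.basis k) (bit (H + i)) = h k C i := by
  have h1 : H ≤ H + i.1 ∧ H + i.1 < H + n := by omega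
  have := toVec_bit (hv.basis k) ⟨H + i.1, by omega⟩
  rw [this, basis, Module.Basis.reindex_apply, Equiv.symm_symm, Equiv.ofBijective_apply, index,
    dif_pos h1]
  simp [h]

theorem toVec_bit_of_vec {t : ℕ} (ht : isRootPos H n t = true) {a : Fin n → ℤ}
    (h : vec T n t = a) : toVec (hv.basis k) (bit t) = eAux k C a := by
  subst h
  rw [hv.toVec_bit_root k ht]
  exact (eAux_root k ⟨vec T n t, (hv.root_data ht).1⟩).symm

variable [CharP k 2]

omit hv [IsADECartan C] in
theorem intCast_smul {V : Type*} [AddCommGroup V] [Module k V] (m : ℤ) (x : V) :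
    (m : k) • x = cond (m % 2 == 0) 0 x := by
  rcases Int.emod_two_eq_zero_or_one m with h | h
  · have : (m : k) = 0 := (CharP.intCast_eq_zero_iff k 2 m).2 (Int.dvd_of_emod_eq_zero h)
    rw [this, h, zero_smul]
    rfl
  · have h2 : ((m - 1 : ℤ) : k) = 0 :=
      (CharP.intCast_eq_zero_iff k 2 _).2 (Int.dvd_of_emod_eq_zero (by omega))
    rw [Int.cast_sub, Int.cast_one, sub_eq_zero] at h2
    rw [h2, h, one_smul]
    rfl

omit [CharP k 2] in
theorem toVec_cond (b : Bool) (m : ℕ) :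
    toVec (hv.basis k) (cond b 0 m) = cond b 0 (toVec (hv.basis k) m) := by
  cases b
  · rfl
  · exact toVec_zero _

theorem toVec_corootMask (i : ℕ) (l : List (Fin n)) :
    toVec (hv.basis k) (corootMask T H i l) =
      (l.map fun j => ((vec T n i j : ℤ) : k) • h k C j).sum := by
  induction l with
  | nil => exact toVec_zero _
  | cons j l ih =>
    rw [corootMask, toVec_xor, ih, toVec_cond, hv.toVec_bit_cartan k, List.map_cons,
      List.sum_cons, intCast_smul]

/-- Addition of roots is addition of codes up to the offset `zeroCode`, so a search for the shifted
sum of two codes decides whether the sum of the roots is a root. By completeness of the table an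
unsuccessful search means that it is not. -/
theorem isBracket : IsBracket (hv.basis k) (isRootPos H n) (lie T H C) := by
  intro i j hi hj
  obtain ⟨hri, hci, -, hbi⟩ := hv.root_data hi
  rw [hv.toVec_bit_root k hi, lie, lie_def]
  split_ifs with hH
  · have hj' : j = H + (⟨j - H, by omega⟩ : Fin n).1 := by simp only; omega
    rw [toVec_cond, hv.toVec_bit_root k hi]
    conv_lhs => rw [hj']
    rw [hv.toVec_bit_cartan k, bracket_e_h, neg_eq_self, intCast_smul]
  · have hj' : isRootPos H n j = true := isRootPos_iff.2 ⟨hj, hH⟩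
    obtain ⟨hrj, hcj, -, hbj⟩ := hv.root_data hj'
    have hadd := hv.code_add hi hj'
    rw [hv.toVec_bit_root k hj', bracket_e_e, force_eq, force_eq]
    have hzero : code T i + code T j = 2 * zeroCode ↔ vec T n i + vec T n j = 0 := by
      constructor
      · intro h0
        refine hv.inj _ (fun l => ?_) ?_
        · have := hbi l
          have := hbj l
          rw [Pi.add_apply]
          omega
        · have : (code T i : ℤ) + code T j = 2 * zeroCode := by exact_mod_cast h0
          linarith
      · intro h0
        rw [h0] at hadd
        simp only [Pi.zero_apply, zero_mul, Finset.sum_const_zero, add_zero] at hadd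
        exact_mod_cast hadd
    by_cases h0 : vec T n i + vec T n j = 0
    · rw [if_pos h0, beq_iff_eq.2 (hzero.2 h0), cond_true, hv.toVec_corootMask k, coroot,
        Fin.sum_univ_def]
    · rw [if_neg h0, beq_eq_false_iff_ne.2 (hzero.not.2 h0), cond_false]
      by_cases hr : IsRoot C (vec T n i + vec T n j)
      · obtain ⟨t, ht, hvt⟩ := hv.exists_vec_eq _ hr
        obtain ⟨-, hct, hft, -⟩ := hv.root_data ht
        have hs : code T t + zeroCode = code T i + code T j := by
          rw [hvt] at hct
          zify
          linarith
        rw [show code T i + code T j - zeroCode = code T t by omega, hft, ht, Bool.true_and,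
          beq_iff_eq.2 hs, cond_true, hv.toVec_bit_of_vec k ht hvt]
      · rw [eAux, dif_neg hr]
        cases hcase : (isRootPos H n (find T H n (code T i + code T j - zeroCode)) &&
          code T (find T H n (code T i + code T j - zeroCode)) + zeroCode ==
            code T i + code T j)
        · exact (toVec_zero _).symm
        -- A hit in the table would carry the code of the sum, hence be the sum, which would then be
        -- a root.
        · exfalso
          rw [Bool.and_eq_true, beq_iff_eq] at hcase
          obtain ⟨ht, hs⟩ := hcase
          have hvec := hv.vec_eq_of_code (a := vec T n i + vec T n j) ht (fun l => by
            have := hbi l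
            have := hbj l
            rw [Pi.add_apply]
            omega) (by
            zify at hs
            linarith)
          exact hr (hvec ▸ (hv.root_data ht).1)

theorem sumVec_singleton {t : ℕ} (ht : isRootPos H n t = true) {a : Fin n → ℤ}
    (h : vec T n t = a) : sumVec (hv.basis k) [t] = eAux k C a := by
  rw [sumVec_cons, hv.toVec_bit_of_vec k ht h]
  simp [sumVec, ofBits, toVec_zero]

end Valid

end RootTable

/-! ## The adjoint group acts by automorphisms -/

namespace ChevalleyAlgebra

variable (k : Type*) [Field k] {n : ℕ} {C : Matrix (Fin n) (Fin n) ℤ}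

theorem repr_h (i : Fin n) (α : Root C) : (basis k C).repr (h k C i) (Sum.inr α) = 0 := by
  rw [h, Module.Basis.repr_self, Finsupp.single_eq_of_ne (by simp)]

open Classical in
theorem repr_e (α β : Root C) :
    (basis k C).repr (e k β) (Sum.inr α) = if β.1 = α.1 then 1 else 0 := by
  rw [e, Module.Basis.repr_self, Finsupp.single_apply]
  simp [Subtype.ext_iff]

theorem repr_coroot (α β : Root C) : (basis k C).repr (coroot k β) (Sum.inr α) = 0 := by
  simp [coroot, repr_h]

section

variable [IsADECartan C]

/-- Both sides are nonzero exactly when `β + γ = -α`. If `α + β` and `α + γ` are roots, then `(α + β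
| α + γ) = (β | γ)`, so their sum is a root only if `β + γ` is. As `(α | β + γ) = -2`, that root can
only be `-α`. Conversely, `β + γ = -α` makes `α + β = -γ` and `α + γ = -β` roots. -/
theorem bracket_bracket_e_e (α β γ : Root C) (hβ : β.1 ≠ -α.1) (hγ : γ.1 ≠ -α.1) :
    bracket k C (bracket k C (e k α) (e k β)) (bracket k C (e k α) (e k γ)) =
      (basis k C).repr (bracket k C (e k β) (e k γ)) (Sum.inr (negRoot α)) • e k α := by
  classical
  have hα : dotProduct α.1 (C.mulVec α.1) = 2 := α.2
  have hα0 : α.1 ≠ 0 := by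
    intro h0
    rw [h0, zero_dotProduct] at hα
    omega
  have hβ0 : α.1 + β.1 ≠ 0 := fun h0 => hβ (eq_neg_of_add_eq_zero_right h0)
  have hγ0 : α.1 + γ.1 ≠ 0 := fun h0 => hγ (eq_neg_of_add_eq_zero_right h0)
  rw [bracket_e_e k α β, if_neg hβ0, bracket_e_e k α γ, if_neg hγ0, bracket_e_e k β γ]
  have hq : (basis k C).repr (if β.1 + γ.1 = 0 then coroot k β else eAux k C (β.1 + γ.1))
      (Sum.inr (negRoot α)) = if β.1 + γ.1 = -α.1 then 1 else 0 := by
    by_cases h0 : β.1 + γ.1 = 0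
    · rw [if_pos h0, repr_coroot, h0, if_neg fun h1 => hα0 (neg_eq_zero.1 h1.symm)]
    · rw [if_neg h0]
      by_cases hr : IsRoot C (β.1 + γ.1)
      · rw [show eAux k C (β.1 + γ.1) = e k ⟨_, hr⟩ from eAux_root k ⟨_, hr⟩, repr_e]
        rfl
      · rw [eAux, dif_neg hr, map_zero, if_neg]
        · rfl
        · intro h1
          exact hr (h1 ▸ (negRoot α).2)
  rw [hq]
  by_cases hrβ : IsRoot C (α.1 + β.1)
  · by_cases hrγ : IsRoot C (α.1 + γ.1)
    · have h1 := (isRoot_add_iff α β).1 hrβ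
      have h2 := (isRoot_add_iff α γ).1 hrγ
      have h3 : dotProduct (α.1 + β.1) (C.mulVec (α.1 + γ.1)) =
          dotProduct β.1 (C.mulVec γ.1) := by
        rw [Matrix.mulVec_add, add_dotProduct, dotProduct_add, dotProduct_add, hα, h2,
          form_comm β.1 α.1, h1]
        ring
      have h4 := add_eq_zero_iff ⟨_, hrβ⟩ ⟨_, hrγ⟩
      have h5 := isRoot_add_iff ⟨_, hrβ⟩ ⟨_, hrγ⟩
      simp only [h3] at h4 h5
      rw [← add_eq_zero_iff β γ] at h4
      rw [← isRoot_add_iff β γ] at h5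
      rw [show eAux k C (α.1 + β.1) = e k ⟨_, hrβ⟩ from eAux_root k ⟨_, hrβ⟩,
        show eAux k C (α.1 + γ.1) = e k ⟨_, hrγ⟩ from eAux_root k ⟨_, hrγ⟩, bracket_e_e]
      have h6 : ¬ α.1 + β.1 + (α.1 + γ.1) = 0 := by
        intro h0
        have h7 := h4.1 h0
        have h8 : α.1 + α.1 = 0 := by
          have : α.1 + β.1 + (α.1 + γ.1) = α.1 + α.1 + (β.1 + γ.1) := by abel
          rw [← h0, this, h7, add_zero]
        rw [add_eq_zero_iff, hα] at h8
        omega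
      rw [if_neg h6]
      by_cases hs : β.1 + γ.1 = -α.1
      · rw [if_pos hs, one_smul, show α.1 + β.1 + (α.1 + γ.1) = α.1 by
          rw [add_add_add_comm, hs]
          abel]
        exact eAux_root k α
      · rw [if_neg hs, zero_smul, eAux, dif_neg]
        rw [h5]
        intro hr
        have h7 := add_eq_zero_iff α ⟨_, hr⟩
        simp only [Matrix.mulVec_add, dotProduct_add, h1, h2] at h7
        exact hs (eq_neg_of_add_eq_zero_right (h7.2 (by norm_num)))
    · rw [eAux, eAux, dif_neg hrγ, map_zero, if_neg, zero_smul]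
      intro hs
      refine hrγ ?_
      rw [show α.1 + γ.1 = -β.1 by rw [eq_neg_iff_add_eq_zero, add_assoc, add_comm γ.1, hs]; abel]
      exact (negRoot β).2
  · rw [eAux, dif_neg hrβ, map_zero, LinearMap.zero_apply, if_neg, zero_smul]
    intro hs
    refine hrβ ?_
    rw [show α.1 + β.1 = -γ.1 by rw [eq_neg_iff_add_eq_zero, add_assoc, hs]; abel]
    exact (negRoot γ).2

end

theorem repr_bracket_negRoot_e (α γ : Root C) :
    (basis k C).repr (bracket k C (e k (negRoot α)) (e k γ)) (Sum.inr (negRoot α)) = 0 := by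
  classical
  rw [bracket_e_e]
  split_ifs with h0
  · exact repr_coroot k _ _
  · by_cases hr : IsRoot C ((negRoot α).1 + γ.1)
    · rw [show eAux k C ((negRoot α).1 + γ.1) = e k ⟨_, hr⟩ from eAux_root k ⟨_, hr⟩, repr_e,
        if_neg]
      intro h1
      have h2 : γ.1 = 0 := by simpa using h1
      have h3 : dotProduct γ.1 (C.mulVec γ.1) = 2 := γ.2
      rw [h2, zero_dotProduct] at h3
      omega
    · rw [eAux, dif_neg hr, map_zero]
      rfl

variable [CharP k 2] [IsADECartan C]

/-- If `α + γ` is a root, then `h_α` acts on its root vector by `(α | α + γ) = 2 - 1 = 1`; otherwise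
both sides vanish. -/
theorem bracket_coroot_bracket (α γ : Root C) (hγ : γ.1 ≠ -α.1) :
    bracket k C (coroot k α) (bracket k C (e k α) (e k γ)) = bracket k C (e k α) (e k γ) := by
  have hα : dotProduct α.1 (C.mulVec α.1) = 2 := α.2
  have hγ0 : α.1 + γ.1 ≠ 0 := fun h0 => hγ (eq_neg_of_add_eq_zero_right h0)
  rw [bracket_e_e, if_neg hγ0]
  by_cases hr : IsRoot C (α.1 + γ.1)
  · have h1 := eAux_root k ⟨_, hr⟩
    simp only at h1
    rw [h1, bracket_comm, bracket_e_coroot, form_comm]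
    simp only [Matrix.mulVec_add, dotProduct_add, hα, (isRoot_add_iff α γ).1 hr]
    norm_num [neg_eq_self]
  · rw [eAux, dif_neg hr, map_zero]

/-- The quadratic part of the compatibility of root elements with the bracket. -/
theorem bracket_bracket_e (α : Root C) (x y : ChevalleyAlgebra k C) :
    bracket k C (bracket k C (e k α) x) (bracket k C (e k α) y) +
      (basis k C).repr y (Sum.inr (negRoot α)) • bracket k C (e k α) x +
      (basis k C).repr x (Sum.inr (negRoot α)) • bracket k C (e k α) y =
      (basis k C).repr (bracket k C x y) (Sum.inr (negRoot α)) • e k α := by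
  classical
  have hself : bracket k C (e k α) (e k α) = 0 := bracket_self k _
  have hhe : ∀ (i : Fin n) (β : Root C),
      bracket k C (bracket k C (e k α) (h k C i)) (bracket k C (e k α) (e k β)) +
      (basis k C).repr (e k β) (Sum.inr (negRoot α)) • bracket k C (e k α) (h k C i) +
      (basis k C).repr (h k C i) (Sum.inr (negRoot α)) • bracket k C (e k α) (e k β) =
      (basis k C).repr (bracket k C (h k C i) (e k β)) (Sum.inr (negRoot α)) • e k α := by
    intro i β
    rw [bracket_e_h, map_neg, map_smul, LinearMap.neg_apply, LinearMap.smul_apply,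
      bracket_e_e_apply, smul_zero, neg_zero, zero_add, repr_h, zero_smul, add_zero, bracket_h_e,
      map_smul, Finsupp.smul_apply, repr_e]
    split_ifs with hβ
    · rw [hβ, show (negRoot α).1 = -α.1 from rfl, Matrix.mulVec_neg, Pi.neg_apply, Int.cast_neg,
        smul_eq_mul, mul_one, one_smul, neg_smul]
    · rw [zero_smul, smul_zero, zero_smul]
  have hee : ∀ β γ : Root C,
      bracket k C (bracket k C (e k α) (e k β)) (bracket k C (e k α) (e k γ)) +
      (basis k C).repr (e k γ) (Sum.inr (negRoot α)) • bracket k C (e k α) (e k β) +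
      (basis k C).repr (e k β) (Sum.inr (negRoot α)) • bracket k C (e k α) (e k γ) =
      (basis k C).repr (bracket k C (e k β) (e k γ)) (Sum.inr (negRoot α)) • e k α := by
    have key : ∀ γ : Root C, γ.1 ≠ (negRoot α).1 →
        bracket k C (bracket k C (e k α) (e k (negRoot α))) (bracket k C (e k α) (e k γ)) =
          bracket k C (e k α) (e k γ) := by
      intro γ hγ
      rw [bracket_e_e k α (negRoot α),
        if_pos (show α.1 + (negRoot α).1 = 0 from add_neg_cancel α.1),
        bracket_coroot_bracket k α γ hγ]
    intro β γ
    -- If exactly one of `β`, `γ` is `-α`, the double bracket equals the one surviving linear term,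
    -- and the two cancel in characteristic two. If both are, the two linear terms cancel each
    -- other.
    by_cases hβ : β.1 = (negRoot α).1
    · obtain rfl : β = negRoot α := Subtype.ext hβ
      by_cases hγ : γ.1 = (negRoot α).1
      · obtain rfl : γ = negRoot α := Subtype.ext hγ
        rw [bracket_self, bracket_self, repr_e, if_pos rfl, one_smul, zero_add, add_self, map_zero]
        exact (zero_smul k _).symm
      · rw [key γ hγ, repr_e, if_neg hγ, zero_smul, add_zero, repr_e, if_pos rfl, one_smul,
          add_self, repr_bracket_negRoot_e k α γ, zero_smul]
    · by_cases hγ : γ.1 = (negRoot α).1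
      · obtain rfl : γ = negRoot α := Subtype.ext hγ
        rw [bracket_comm, key β hβ, repr_e, if_pos rfl, one_smul, repr_e, if_neg hβ, zero_smul,
          add_zero, add_self, bracket_comm k (e k β), repr_bracket_negRoot_e k α β, zero_smul]
      · rw [repr_e, if_neg hγ, repr_e, if_neg hβ, zero_smul, zero_smul, add_zero, add_zero,
          bracket_bracket_e_e k α β γ hβ hγ]
  induction x using induction_basis with
  | h0 => simp
  | hadd x x' hx hx' =>
    simp only [map_add, LinearMap.add_apply, Finsupp.add_apply, smul_add, add_smul]
    rw [← hx, ← hx']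
    abel
  | hsmul c x hx =>
    simp only [map_smul, LinearMap.smul_apply, Finsupp.smul_apply, smul_eq_mul, mul_smul]
    rw [← hx]
    module
  | hb i =>
    induction y using induction_basis with
    | h0 => simp
    | hadd y y' hy hy' =>
      simp only [map_add, Finsupp.add_apply, smul_add, add_smul]
      rw [← hy, ← hy']
      abel
    | hsmul c y hy =>
      simp only [map_smul, Finsupp.smul_apply, smul_eq_mul, mul_smul]
      rw [← hy]
      module
    | hb j =>
      rcases i with i | β <;> rcases j with j | γ
      · change bracket k C (bracket k C (e k α) (h k C i)) (bracket k C (e k α) (h k C j)) +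
          (basis k C).repr (h k C j) _ • _ + (basis k C).repr (h k C i) _ • _ =
          (basis k C).repr (bracket k C (h k C i) (h k C j)) _ • _
        rw [bracket_e_h, bracket_e_h, repr_h, repr_h, bracket_h_h]
        simp [hself]
      · exact hhe i γ
      · have h1 := hhe j β
        change bracket k C (bracket k C (e k α) (e k β)) (bracket k C (e k α) (h k C j)) +
          (basis k C).repr (h k C j) _ • bracket k C (e k α) (e k β) +
          (basis k C).repr (e k β) _ • bracket k C (e k α) (h k C j) =
          (basis k C).repr (bracket k C (e k β) (h k C j)) _ • _
        rw [bracket_comm k (e k β) (h k C j), ← h1,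
          bracket_comm k (bracket k C (e k α) (e k β))]
        abel
      · exact hee β γ

/-- Comparison of powers of `t`: the linear terms agree because `ad e_α` is a derivation, the
quadratic ones by `bracket_bracket_e`, and the cubic and quartic terms vanish since `(ad e_α)² = 0`
and `[e_α, e_α] = 0`. -/
theorem rootEnd_lie (α : Root C) (t : k) (x y : ChevalleyAlgebra k C) :
    rootEnd k α t ⁅x, y⁆ = ⁅rootEnd k α t x, rootEnd k α t y⁆ := by
  have h1 := bracket_bracket_e k α x y
  simp only [← lie_def] at h1
  have h2 : ∀ z : ChevalleyAlgebra k C, ⁅e k α, ⁅e k α, z⁆⁆ = 0 := bracket_e_e_apply k α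
  have h3 : ∀ z : ChevalleyAlgebra k C, ⁅⁅e k α, z⁆, e k α⁆ = 0 := fun z => by
    rw [← lie_skew, h2, neg_zero]
  have h4 : ⁅x, e k α⁆ = ⁅e k α, x⁆ := bracket_comm k _ _
  simp only [rootEnd_apply, sub_eq_add_neg, neg_eq_self, add_lie, lie_add, smul_lie, lie_smul,
    h2, h3, h4, lie_self, smul_zero, add_zero, leibniz_lie (e k α) x y]
  rw [mul_smul, ← h1]
  simp only [smul_add, smul_smul]
  rw [pow_two]
  abel

theorem lie_of_mem_adjointGroup {φ : ChevalleyAlgebra k C ≃ₗ[k] ChevalleyAlgebra k C}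
    (hφ : φ ∈ adjointGroup k C) (x y : ChevalleyAlgebra k C) : φ ⁅x, y⁆ = ⁅φ x, φ y⁆ := by
  induction hφ using Subgroup.closure_induction generalizing x y with
  | mem φ hφ =>
    obtain ⟨α, t, rfl⟩ := hφ
    exact rootEnd_lie k α t x y
  | one => rfl
  | mul φ ψ _ _ hφ hψ =>
    rw [LinearEquiv.mul_apply, LinearEquiv.mul_apply, LinearEquiv.mul_apply, hψ, hφ]
  | inv φ _ hφ =>
    refine φ.injective ?_
    rw [hφ]
    change φ (φ.symm _) = ⁅φ (φ.symm _), φ (φ.symm _)⁆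
    simp only [LinearEquiv.apply_symm_apply]

end ChevalleyAlgebra

/-! ### Transport of bitmask vectors along a linear equivalence -/

namespace BitMask

variable {k : Type*} [Field k] {V W : Type*} [AddCommGroup V] [Module k V] [AddCommGroup W]
  [Module k W] {D : ℕ}

theorem toVec_map (B : Module.Basis (Fin D) k V) (φ : V ≃ₗ[k] W) (m : ℕ) :
    toVec (B.map φ) m = φ (toVec B m) := by
  simp only [toVec, map_sum, map_smul, Module.Basis.map_apply]

theorem sumVec_map (B : Module.Basis (Fin D) k V) (φ : V ≃ₗ[k] W) (l : List ℕ) :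
    sumVec (B.map φ) l = φ (sumVec B l) := toVec_map B φ _

end BitMask

/-! ### From a certificate to a whole orbit -/

namespace RootTable

open BitMask ChevalleyAlgebra

variable {T H n : ℕ} {C : Matrix (Fin n) (Fin n) ℤ}

/-- The list contains the positions of the simple roots and their negatives. -/
def checkGenerators (T H n : ℕ) (gens : List (List ℕ)) : Bool :=
  (List.finRange n).all fun i => gens.contains [find T H n (zeroCode + weight i).toNat] &&
    gens.contains [find T H n (zeroCode - weight i).toNat]

variable (k : Type*) [Field k] [CharP k 2] [IsADECartan C]

theorem Valid.eq_top (hv : Valid T H C) {gens : List (List ℕ)}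
    (hg : checkGenerators T H n gens = true) {N : LieSubalgebra k (ChevalleyAlgebra k C)}
    (hN : ∀ t ∈ gens, sumVec (hv.basis k) t ∈ N) : N = ⊤ := by
  simp only [checkGenerators, List.all_eq_true, List.mem_finRange, forall_const,
    Bool.and_eq_true, List.contains_iff_mem] at hg
  refine eq_top_of_simple_mem k (fun i => ?_) fun i => ?_
  · obtain ⟨h1, h2⟩ := hv.vec_find_pos i
    rw [← hv.sumVec_singleton k h1 h2]
    exact hN _ (hg i).1
  · obtain ⟨h1, h2⟩ := hv.vec_find_neg i
    rw [← hv.sumVec_singleton k h1 h2]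
    exact hN _ (hg i).2

theorem Valid.sumVec_eq_sumSimple (hv : Valid T H C) (i j l : Fin n) :
    sumVec (hv.basis k) [find T H n (zeroCode + weight i).toNat,
      find T H n (zeroCode + weight j).toNat, find T H n (zeroCode + weight l).toNat] =
      sumSimple k C i j l := by
  have key : ∀ i : Fin n, toVec (hv.basis k) (bit (find T H n (zeroCode + weight i).toNat)) =
      e k (simpleRoot i) := by
    intro i
    obtain ⟨h1, h2⟩ := hv.vec_find_pos i
    rw [hv.toVec_bit_of_vec k h1 h2]
    exact eAux_root k (simpleRoot i)
  rw [sumVec_cons, sumVec_cons, sumVec_cons, key, key, key, sumSimple, add_assoc]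
  simp [sumVec, ofBits, toVec_zero]

/-- A sum of Cartan elements acts on `e_β` by pairing `β` with the sum of the corresponding rows of
the Cartan matrix. If this row sum is even, the sum is central in characteristic two. -/
theorem Valid.lie_cartan_eq_zero (hv : Valid T H C) (l : List (Fin n))
    (hl : ∀ j, (l.map fun i => C i j).sum % 2 = 0) (x : ChevalleyAlgebra k C) :
    ⁅sumVec (hv.basis k) (l.map fun i => H + i.1), x⁆ = 0 := by
  have hsum : sumVec (hv.basis k) (l.map fun i => H + i.1) = (l.map (h k C)).sum := by
    clear hl
    induction l with
    | nil => exact toVec_zero _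
    | cons i l ih =>
      rw [List.map_cons, sumVec_cons, ih, hv.toVec_bit_cartan k, List.map_cons, List.sum_cons]
  have hh : ∀ j, bracket k C (l.map (h k C)).sum (h k C j) = 0 := by
    clear hl hsum
    intro j
    induction l with
    | nil => simp
    | cons i l ih =>
      rw [List.map_cons, List.sum_cons, map_add, LinearMap.add_apply, ih, bracket_h_h, add_zero]
  have he : ∀ β : Root C, bracket k C (l.map (h k C)).sum (e k β) =
      ((dotProduct (fun j => (l.map fun i => C i j).sum) β.1 : ℤ) : k) • e k β := by
    clear hl hsum hh
    intro β
    induction l with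
    | nil => simp
    | cons i l ih =>
      simp only [List.map_cons, List.sum_cons]
      rw [map_add, LinearMap.add_apply, ih, bracket_h_e, ← add_smul, ← Int.cast_add]
      congr 2
      rw [Matrix.mulVec, ← add_dotProduct]
      rfl
  rw [hsum, lie_def]
  induction x using induction_basis with
  | h0 => exact map_zero _
  | hadd x y hx hy => rw [map_add, hx, hy, add_zero]
  | hsmul c x hx => rw [map_smul, hx, smul_zero]
  | hb i =>
    rcases i with i | β
    · exact hh i
    · refine (he β).trans ?_
      have : (2 : ℤ) ∣ dotProduct (fun j => (l.map fun i => C i j).sum) β.1 :=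
        Finset.dvd_sum fun j _ => Dvd.dvd.mul_right (Int.dvd_of_emod_eq_zero (hl j)) _
      rw [(CharP.intCast_eq_zero_iff k 2 _).2 this, zero_smul]

/-- A certificate proves the maximality of the normaliser of the radical for all elements of an
orbit of the adjoint group. -/
theorem Valid.isCoatom_of_mem_adjointOrbit (hv : Valid T H C) {c : Certificate}
    (hn : c.checkNormalizer (isRootPos H n) (lie T H C) (2 * H + n) = true)
    (hr : c.checkRadical (isRootPos H n) (lie T H C) (2 * H + n) = true)
    (hm : c.checkMaximal (isRootPos H n) (lie T H C) (2 * H + n) = true)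
    (hg : checkGenerators T H n c.gens = true)
    (hc : ∀ t ∈ c.center, ∃ l : List (Fin n), t = l.map (fun i => H + i.1) ∧
      ∀ j, (l.map fun i => C i j).sum % 2 = 0) {i j l : Fin n}
    (he : c.e = [find T H n (zeroCode + weight i).toNat,
      find T H n (zeroCode + weight j).toNat, find T H n (zeroCode + weight l).toNat])
    {x : ChevalleyAlgebra k C} (hx : x ∈ adjointOrbit k (sumSimple k C i j l)) :
    Module.finrank k (normalizerOfRadical (k := k) x) = c.dim ∧
      IsCoatom (normalizerOfRadical (k := k) x) := by
  obtain ⟨φ, hφ, rfl⟩ := hx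
  have hlie := lie_of_mem_adjointGroup k hφ
  -- The image of the representative under `φ` has the same bitmask in the basis moved by `φ`. As
  -- `φ` is an automorphism, that basis has the same structure constants and the same certificate
  -- applies.
  rw [← hv.sumVec_eq_sumSimple k i j l, ← he, ← sumVec_map]
  refine Certificate.isCoatom_normalizerOfRadical (adm := isRootPos H n) (br := lie T H C)
    (fun a b ha hb => ?_) (fun a ha => (isRootPos_iff.1 ha).1) (fun t ht x => ?_) hn hr hm
    (fun N hN => ?_)
  · rw [toVec_map, toVec_map, toVec_map, ← hlie, hv.isBracket k a b ha hb]
  · obtain ⟨s, rfl, hs⟩ := hc t ht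
    obtain ⟨y, rfl⟩ := φ.surjective x
    rw [sumVec_map, ← hlie, hv.lie_cartan_eq_zero k s hs, map_zero]
  -- Generation is known for the original basis, so `N` is pulled back along the automorphism.
  · let ψ : ChevalleyAlgebra k C →ₗ⁅k⁆ ChevalleyAlgebra k C :=
      { φ.toLinearMap with map_lie' := fun {x y} => hlie x y }
    have htop : N.comap ψ = ⊤ := hv.eq_top k hg fun t ht => by
      have := hN t ht
      rw [sumVec_map] at this
      exact this
    rw [eq_top_iff]
    intro y _
    obtain ⟨z, rfl⟩ := φ.surjective y
    have hz : z ∈ N.comap ψ := by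
      rw [htop]
      trivial
    exact hz

end RootTable

/-! ### Injectivity of the encoding and validity of the three tables -/

namespace RootTable

open BitMask

theorem eq_zero_of_add_mul {a r : ℤ} (ha : -28 ≤ a ∧ a ≤ 28) (h : a + 32 * r = 0) :
    a = 0 ∧ r = 0 := by omega

/-- The weights are, up to sign, the powers `32 ^ 0, …, 32 ^ 7`. With digits of absolute value below
32 the sum vanishes only digit by digit, starting from the lowest one. -/
theorem eq_zero_of_sum_weight (d : ℕ → ℤ) (hd : ∀ i, -28 ≤ d i ∧ d i ≤ 28)
    (h : d 0 * weight 0 + d 1 * weight 1 + d 2 * weight 2 + d 3 * weight 3 + d 4 * weight 4 +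
      d 5 * weight 5 + d 6 * weight 6 + d 7 * weight 7 = 0) :
    ∀ i < 8, d i = 0 := by
  simp only [show weight 0 = 1 from rfl, show weight 1 = -32 ^ 4 from rfl,
    show weight 2 = 32 ^ 7 from rfl, show weight 3 = 32 from rfl,
    show weight 4 = 32 ^ 5 from rfl, show weight 5 = 32 ^ 2 from rfl,
    show weight 6 = -32 ^ 6 from rfl, show weight 7 = -32 ^ 3 from rfl] at h
  have hneg : ∀ i, -28 ≤ -d i ∧ -d i ≤ 28 := fun i => by
    have := hd i
    omega
  -- Horner form of the sum, in the order of the exponents given by `expo`.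
  obtain ⟨h0, h⟩ := eq_zero_of_add_mul (r := d 3 + 32 * (d 5 + 32 * (-d 7 + 32 * (-d 1 + 32 *
    (d 4 + 32 * (-d 6 + 32 * d 2)))))) (hd 0) (by linarith)
  obtain ⟨h3, h⟩ := eq_zero_of_add_mul (hd 3) h
  obtain ⟨h5, h⟩ := eq_zero_of_add_mul (hd 5) h
  obtain ⟨h7, h⟩ := eq_zero_of_add_mul (hneg 7) h
  obtain ⟨h1, h⟩ := eq_zero_of_add_mul (hneg 1) h
  obtain ⟨h4, h⟩ := eq_zero_of_add_mul (hd 4) h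
  obtain ⟨h6, h2⟩ := eq_zero_of_add_mul (hneg 6) h
  rw [neg_eq_zero] at h7 h1 h6
  intro i hi
  interval_cases i <;> assumption

theorem eq_zero_of_sum_weight_fin {n : ℕ} (hn : n ≤ 8) (d : Fin n → ℤ)
    (hd : ∀ i, -28 ≤ d i ∧ d i ≤ 28) (h : ∑ i, d i * weight i = 0) : d = 0 := by
  let f : ℕ → ℤ := fun i => if hi : i < n then d ⟨i, hi⟩ else 0
  have hf : ∀ i : Fin n, f i = d i := fun i => dif_pos i.2
  have hsum : ∑ i ∈ Finset.range 8, f i * weight i = 0 := by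
    rw [← Finset.sum_subset (Finset.range_subset_range.2 hn), Finset.sum_range, ← h]
    · simp only [hf]
    · intro i _ hi
      rw [Finset.mem_range] at hi
      rw [show f i = 0 from dif_neg hi, zero_mul]
  have key := eq_zero_of_sum_weight f (fun i => ?_) (by
    simpa only [Finset.sum_range_succ, Finset.sum_range_zero, zero_add] using hsum)
  · funext i
    rw [← hf]
    exact key i (by omega)
  · simp only [f]
    split_ifs
    · exact hd _
    · decide

theorem valid6 : Valid table6 36 CartanMatrix.E₆ :=
  ⟨by decide +kernel, by decide +kernel, eq_zero_of_sum_weight_fin (by decide)⟩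

theorem valid7 : Valid table7 63 CartanMatrix.E₇ :=
  ⟨by decide +kernel, by decide +kernel, eq_zero_of_sum_weight_fin (by decide)⟩

theorem valid8 : Valid table8 120 CartanMatrix.E₈ :=
  ⟨by decide +kernel, by decide +kernel, eq_zero_of_sum_weight_fin le_rfl⟩
end RootTable

/-! ### The theorem for each of the three types -/

set_option maxHeartbeats 0 in
theorem isCoatom_normalizerOfRadical_E₆ (k : Type*) [Field k] [CharP k 2]
    {e : ChevalleyAlgebra k CartanMatrix.E₆}
    (he : e ∈ ChevalleyAlgebra.adjointOrbit k (ChevalleyAlgebra.sumSimple k _ 0 3 5)) :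
    Module.finrank k (normalizerOfRadical (k := k) e) = 43 ∧
      IsCoatom (normalizerOfRadical (k := k) e) :=
  RootTable.valid6.isCoatom_of_mem_adjointOrbit k (c := RootTable.certificate6)
    (by decide +kernel) (by decide +kernel) (by decide +kernel) (by decide +kernel)
    (by simp [RootTable.certificate6]) (by decide +kernel) he

set_option maxHeartbeats 0 in
theorem isCoatom_normalizerOfRadical_E₇ (k : Type*) [Field k] [CharP k 2]
    {e : ChevalleyAlgebra k CartanMatrix.E₇}
    (he : e ∈ ChevalleyAlgebra.adjointOrbit k (ChevalleyAlgebra.sumSimple k _ 0 3 5)) :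
    Module.finrank k (normalizerOfRadical (k := k) e) = 74 ∧
      IsCoatom (normalizerOfRadical (k := k) e) :=
  RootTable.valid7.isCoatom_of_mem_adjointOrbit k (c := RootTable.certificate7)
    (by decide +kernel) (by decide +kernel) (by decide +kernel) (by decide +kernel)
    -- In Bourbaki numbering `h₂ + h₅ + h₇` spans the recorded centre: rows 2, 5 and 7 of the Cartan
    -- matrix of `E₇` have even sum.
    (fun t ht => ⟨[1, 4, 6], by simpa [RootTable.certificate7] using ht, by decide +kernel⟩)
    (by decide +kernel) he

set_option maxHeartbeats 0 in
theorem isCoatom_normalizerOfRadical_E₈ (k : Type*) [Field k] [CharP k 2]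
    {e : ChevalleyAlgebra k CartanMatrix.E₈}
    (he : e ∈ ChevalleyAlgebra.adjointOrbit k (ChevalleyAlgebra.sumSimple k _ 0 3 5)) :
    Module.finrank k (normalizerOfRadical (k := k) e) = 141 ∧
      IsCoatom (normalizerOfRadical (k := k) e) :=
  RootTable.valid8.isCoatom_of_mem_adjointOrbit k (c := RootTable.certificate8)
    (by decide +kernel) (by decide +kernel) (by decide +kernel) (by decide +kernel)
    (by simp [RootTable.certificate8]) (by decide +kernel) he

theorem mainTheorem10 (k : Type*) [Field k] [IsAlgClosed k] [CharP k 2] :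
    (∀ e ∈ ChevalleyAlgebra.adjointOrbit k (ChevalleyAlgebra.sumSimple k CartanMatrix.E₆ 0 3 5),
      Module.finrank k (normalizerOfRadical (k := k) e) = 43 ∧
        IsCoatom (normalizerOfRadical (k := k) e)) ∧
    (∀ e ∈ ChevalleyAlgebra.adjointOrbit k (ChevalleyAlgebra.sumSimple k CartanMatrix.E₇ 0 3 5),
      Module.finrank k (normalizerOfRadical (k := k) e) = 74 ∧
        IsCoatom (normalizerOfRadical (k := k) e)) ∧
    (∀ e ∈ ChevalleyAlgebra.adjointOrbit k (ChevalleyAlgebra.sumSimple k CartanMatrix.E₈ 0 3 5),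
      Module.finrank k (normalizerOfRadical (k := k) e) = 141 ∧
        IsCoatom (normalizerOfRadical (k := k) e)) :=
  ⟨fun _ he => isCoatom_normalizerOfRadical_E₆ k he,
    fun _ he => isCoatom_normalizerOfRadical_E₇ k he,
    fun _ he => isCoatom_normalizerOfRadical_E₈ k he⟩
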